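/- Let $n\ge 2$ be an integer, $\mu>0$, $\beta>2$ and $1<p<p_S(n)$, where $\gamma(p,n)=2+(n+1)p-(n-1)p^2$ and $p_S(n)=\frac{n+1+\sqrt{n^2+10n-7}}{2(n-1)}$ is the positive root of $\gamma(\cdot,n)$. Let $f\in H^1(\mathbf R^n)$ and $g\in L^2(\mathbf R^n)$ be non-negative, neither of them vanishing identically, with $\operatorname{supp} f,\operatorname{supp} g\subset\{|x|\le 1\}$. For $\varepsilon>0$ consider $$u_{tt}-\Delta u+\frac{\mu}{(1+|x|)^{\beta}}u_t=|u|^p,\qquad u(0,x)=\varepsilon f(x),\quad u_t(0,x)=\varepsilon g(x).\tag{1}$$ An energy solution of (1) on $[0,T)$, $0<T<\infty$, is a function $u\in C([0,T),H^1(\mathbf R^n))\cap C^1([0,T),L^2(\mathbf R^n))\cap L^p_{loc}((0,T)\times\mathbf R^n)$ with $u(0,\cdot)=\varepsilon f$, $u_t(0,\cdot)=\varepsilon g$ such that for every $\Psi\in C_c^\infty([0,T)\times\mathbf R^n)$ the function $|u|^p\Psi$ is integrable on $(0,T)\times\mathbf R^n$ and $$\varepsilon\int_{\mathbf R^n} g\,\Psi(0,x)\,dx+\varepsilon\int_{\mathbf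 R^n}\frac{\mu f\,\Psi(0,x)}{(1+|x|)^\beta}dx+\int_0^T\!\!\int_{\mathbf R^n}|u|^p\Psi\,dxdt=-\int_0^T\!\!\int_{\mathbf R^n}u_t\Psi_t\,dxdt+\int_0^T\!\!\int_{\mathbf R^n}\nabla u\cdot\nabla\Psi\,dxdt-\int_0^T\!\!\int_{\mathbf R^n}\frac{\mu\,u\Psi_t}{(1+|x|)^\beta}dxdt .$$ Then there exist constants $\varepsilon_0>0$ and $C>0$, depending only on $f,g,n,p,\mu,\beta$, such that for every $0<\varepsilon\le\varepsilon_0$ and every $0<T<\infty$: if (1) has an energy solution $u$ on $[0,T)$ with $\operatorname{supp}u\subset\{(t,x)\in[0,T)\times\mathbf R^n:|x|\le t+1\}$, then $$T\le\begin{cases}C\varepsilon^{-\frac{2(p-1)}{n+1-(n-1)p}}&\text{if }1<p\le\frac{n}{n-1},\\[2mm] C\varepsilon^{-\frac{2p(p-1)}{\gamma(p,n)}}&\text{if }\frac{n}{n-1}<p<p_S(n).\end{cases}$$ -/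

import Mathlib

open MeasureTheory Set
open scoped ContDiff

/-- The quadratic polynomial `γ(p, n) = 2 + (n + 1) p - (n - 1) p ^ 2`. -/
noncomputable def gammaPoly (p : ℝ) (n : ℕ) : ℝ :=
  2 + ((n : ℝ) + 1) * p - ((n : ℝ) - 1) * p ^ 2

/-- The Strauss exponent `p_S(n)`: the positive root of `γ(p, n) = 0` (for `n ≥ 2`), see
`gammaPoly_eq_zero_iff`. -/
noncomputable def straussExponent (n : ℕ) : ℝ :=
  ((n : ℝ) + 1 + √((n : ℝ) ^ 2 + 10 * n - 7)) / (2 * ((n : ℝ) - 1))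

theorem gammaPoly_eq_zero_iff {n : ℕ} (hn : 2 ≤ n) {p : ℝ} (hp : 0 < p) :
    gammaPoly p n = 0 ↔ p = straussExponent n := by
  have hn' : (2 : ℝ) ≤ n := by exact_mod_cast hn
  have hd : (0 : ℝ) < 2 * ((n : ℝ) - 1) := by linarith
  have h0 : (0 : ℝ) ≤ (n : ℝ) ^ 2 + 10 * n - 7 := by nlinarith
  have hs := Real.sq_sqrt h0
  have hs0 := Real.sqrt_nonneg ((n : ℝ) ^ 2 + 10 * n - 7)
  unfold gammaPoly straussExponent
  rw [eq_div_iff hd.ne']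
  set s := √((n : ℝ) ^ 2 + 10 * n - 7)
  have hsn : (n : ℝ) + 1 < s := by nlinarith
  constructor
  · intro h
    have h1 : (p * (2 * ((n : ℝ) - 1)) - ((n : ℝ) + 1 + s))
        * (p * (2 * ((n : ℝ) - 1)) - ((n : ℝ) + 1 - s)) = 0 := by
      linear_combination (-4 * ((n : ℝ) - 1)) * h - hs
    rcases mul_eq_zero.mp h1 with h2 | h2
    · linarith
    · have := mul_pos hp hd
      linarith
  · intro h
    have h1 : (-4 * ((n : ℝ) - 1)) * (2 + ((n : ℝ) + 1) * p - ((n : ℝ) - 1) * p ^ 2) = 0 := by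
      linear_combination (p * (2 * ((n : ℝ) - 1)) - ((n : ℝ) + 1 - s)) * h + hs
    rcases mul_eq_zero.mp h1 with h2 | h2
    · linarith
    · exact h2

/-- `G` is the weak (distributional) gradient of `f` on `ℝⁿ`: for every `φ ∈ C_c^∞(ℝⁿ)` and
every direction `e`, `∫ f ∂_e φ = - ∫ (G · e) φ`. -/
def HasWeakGradient {n : ℕ} (f : EuclideanSpace ℝ (Fin n) → ℝ)
    (G : EuclideanSpace ℝ (Fin n) → EuclideanSpace ℝ (Fin n)) : Prop :=
  ∀ φ : EuclideanSpace ℝ (Fin n) → ℝ, ContDiff ℝ ∞ φ → HasCompactSupport φ →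
    ∀ e : EuclideanSpace ℝ (Fin n),
      ∫ x, f x * fderiv ℝ φ x e = - ∫ x, inner ℝ (G x) e * φ x

/-- `f ∈ H¹(ℝⁿ)`. -/
def MemH1 {n : ℕ} (f : EuclideanSpace ℝ (Fin n) → ℝ) : Prop :=
  MemLp f 2 volume ∧
    ∃ G : EuclideanSpace ℝ (Fin n) → EuclideanSpace ℝ (Fin n),
      MemLp G 2 volume ∧ HasWeakGradient f G

/-- The damping coefficient `μ / (1 + |x|) ^ β`. -/
noncomputable def damping {n : ℕ} (μ β : ℝ) (x : EuclideanSpace ℝ (Fin n)) : ℝ :=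
  μ / (1 + ‖x‖) ^ β

/-- Test functions in `C_c^∞([0, T) × ℝⁿ)`, i.e. the restrictions to `t ≥ 0` of smooth functions
with compact support in `(-∞, T) × ℝⁿ`; they need not vanish at `t = 0`. -/
structure IsTestFunction {n : ℕ} (T : ℝ) (Ψ : ℝ → EuclideanSpace ℝ (Fin n) → ℝ) : Prop where
  smooth : ContDiff ℝ ∞ (Function.uncurry Ψ)
  compact : HasCompactSupport (Function.uncurry Ψ)
  lt_T : ∀ z ∈ tsupport (Function.uncurry Ψ), z.1 < T

/-- `u`, with time derivative `V` and spatial weak gradient `G`, is an energy solution on `[0, T)` of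
`u_tt - Δu + μ (1 + |x|)^(-β) u_t = |u|^p`, `u(0) = ε f`, `u_t(0) = ε g`. Here `u` is a function of
`(t, x)` and `U : [0, T) → L²(ℝⁿ)` is the curve `t ↦ u(t, ·)`. Values at times outside `[0, T)`
play no role. -/
structure IsEnergySolutionWith {n : ℕ} (μ β p ε : ℝ) (f g : EuclideanSpace ℝ (Fin n) → ℝ) (T : ℝ)
    (u : ℝ → EuclideanSpace ℝ (Fin n) → ℝ)
    (U V : ℝ → Lp ℝ 2 (volume : Measure (EuclideanSpace ℝ (Fin n))))
    (G : ℝ → Lp (EuclideanSpace ℝ (Fin n)) 2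
      (volume : Measure (EuclideanSpace ℝ (Fin n)))) : Prop where
  /-- `U t` is the class of `u(t, ·)` -/
  curve : ∀ t ∈ Ico 0 T, u t =ᵐ[volume] U t
  /-- `u ∈ C([0, T), H¹)`: `u(t)` has the weak gradient `G t`, and `t ↦ u(t)`, `t ↦ ∇u(t)` are
  continuous into `L²` -/
  weakGradient : ∀ t ∈ Ico 0 T, HasWeakGradient (U t) (G t)
  continuousOn : ContinuousOn U (Ico 0 T)
  continuousOn_gradient : ContinuousOn G (Ico 0 T)
  /-- `u ∈ C¹([0, T), L²)` with `u_t = V` -/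
  hasDeriv : ∀ t ∈ Ico 0 T, HasDerivWithinAt U (V t) (Ico 0 T) t
  continuousOn_deriv : ContinuousOn V (Ico 0 T)
  /-- `u ∈ L^p_loc((0, T) × ℝⁿ)` -/
  memLp_loc : ∀ K : Set (ℝ × EuclideanSpace ℝ (Fin n)), IsCompact K → K ⊆ Ioo 0 T ×ˢ univ →
    MemLp (Function.uncurry u) (ENNReal.ofReal p) (volume.restrict K)
  /-- initial data -/
  initial : U 0 =ᵐ[volume] fun x => ε * f x
  initial_deriv : V 0 =ᵐ[volume] fun x => ε * g x
  /-- the nonlinear term of the weak formulation is a convergent integral -/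
  integrable : ∀ Ψ : ℝ → EuclideanSpace ℝ (Fin n) → ℝ, IsTestFunction T Ψ →
    IntegrableOn (fun z : ℝ × EuclideanSpace ℝ (Fin n) => |u z.1 z.2| ^ p * Ψ z.1 z.2)
      (Ioo 0 T ×ˢ univ)
  /-- the weak formulation -/
  weak : ∀ Ψ : ℝ → EuclideanSpace ℝ (Fin n) → ℝ, IsTestFunction T Ψ →
    ε * (∫ x, g x * Ψ 0 x) + ε * (∫ x, damping μ β x * f x * Ψ 0 x)
        + (∫ t in (0 : ℝ)..T, ∫ x, |u t x| ^ p * Ψ t x)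
      = - (∫ t in (0 : ℝ)..T, ∫ x, V t x * deriv (fun s => Ψ s x) t)
        + (∫ t in (0 : ℝ)..T, ∫ x, inner ℝ (G t x) (gradient (Ψ t) x))
        - (∫ t in (0 : ℝ)..T, ∫ x, damping μ β x * u t x * deriv (fun s => Ψ s x) t)

/-- `u` is an energy solution on `[0, T)` of `u_tt - Δu + μ (1 + |x|)^(-β) u_t = |u|^p`,
`u(0) = ε f`, `u_t(0) = ε g`. -/
def IsEnergySolution {n : ℕ} (μ β p ε : ℝ) (f g : EuclideanSpace ℝ (Fin n) → ℝ) (T : ℝ)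
    (u : ℝ → EuclideanSpace ℝ (Fin n) → ℝ) : Prop :=
  ∃ (U V : ℝ → Lp ℝ 2 (volume : Measure (EuclideanSpace ℝ (Fin n))))
    (G : ℝ → Lp (EuclideanSpace ℝ (Fin n)) 2 (volume : Measure (EuclideanSpace ℝ (Fin n)))),
    IsEnergySolutionWith μ β p ε f g T u U V G

/-- The support of `u` on `[0, T) × ℝⁿ` lies in the cone `|x| ≤ t + 1`. -/
def SupportedInCone {n : ℕ} (T : ℝ) (u : ℝ → EuclideanSpace ℝ (Fin n) → ℝ) : Prop :=
  ∀ t ∈ Ico 0 T, ∀ᵐ x ∂(volume : Measure (EuclideanSpace ℝ (Fin n))), t + 1 < ‖x‖ → u t x = 0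

/-! The proof is a test function argument. Let `q = p / (p - 1)`, let `a` be a time cutoff at scale
`T`, and let `J` be the integral of `a(t) |u|^p` over `(0, T) × ℝⁿ`. The equation is tested twice,
and each time the terms linear in `u` are estimated by Hölder on the cone `|x| ≤ t + 1`.

Testing with `a(t)`, cut off in space outside the cone, leaves no Laplacian term. It gives `ε ∫ g +
J ≤ J^(1/p) B`, where `B` is of order `T^(1/q) (T⁻² ‖1‖ + T⁻¹ ‖damping‖)` with `L^q` norms over the
ball of radius `T + 1`. Absorbing `J` yields both `ε ∫ g ≤ B^q` and `J^(1/p) ≤ B^(q-1)`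
(`bounds_of_add_le_rpow_mul`).

If `p ≤ n/(n-1)`, then `q ≥ n`, the damping lies in `L^q(ℝⁿ)`, and `B` is of order `T^(1/q - 1)`.
The first inequality then gives `T ≤ M ε^(-(p-1))`, which implies the claim for `ε ≤ 1`.

If `n/(n-1) < p`, the second inequality bounds `J` from above, with `B` of order `T^(-2 + (n+1)/q)`.
A lower bound comes from testing with `a(t) e^(-t) φ(x)`, where `Δφ = (1 + damping) φ`. Since
`e^(-t) φ` solves the adjoint linear equation, only terms with `a'` or `a''` survive, and `ε ∫ g /
2` is at most `J^(1/p)` times a power of `T`. The sharp growth `φ ≤ K (1 + |x|)^(-(n-1)/2) e^|x|`,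
valid because the damping is `O(|x|⁻²)`, makes the two bounds combine into the exponent with `γ(p,
n)`, positive below the Strauss exponent.

The function `φ` is radial and is built as a fixed point of an integral equation. The damping is not
smooth at the origin, so `φ` need not be an admissible test function. It is replaced on the relevant
ball by a polynomial in `|x|²` with an arbitrarily small error in the equation, while the growth
constant stays independent of the ball (`exists_smooth_approx_eigenfunction`). -/

/-! ### Time cutoffs -/

/-- A high power of a bump function works: differentiating twice costs two powers of the bump, and
what remains still dominates the `1/p`-th power. Rescaling by `T` produces the factors `T⁻¹`, with
`C` independent of `T`. -/
theorem exists_time_cutoff {p : ℝ} (hp : 1 < p) :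
    ∃ C : ℝ, 0 < C ∧ ∀ T : ℝ, 0 < T → ∃ a : ℝ → ℝ, ContDiff ℝ ∞ a ∧ (∀ t, 0 ≤ a t) ∧
      (∀ t, a t ≤ 1) ∧ a 0 = 1 ∧ deriv a 0 = 0 ∧ (∀ t, T / 2 ≤ |t| → a t = 0) ∧
      (∀ t, 0 ≤ t → t < T / 4 → deriv a t = 0 ∧ deriv (deriv a) t = 0) ∧
      (∀ t, |deriv a t| ≤ C * T⁻¹ * a t ^ (1 / p)) ∧
      (∀ t, |deriv (deriv a) t| ≤ C * T⁻¹ ^ 2 * a t ^ (1 / p)) := by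
  -- This choice means `k / p < k - 2`, so `b^(k-2) ≤ (b^k)^(1/p)` for `0 ≤ b ≤ 1`.
  obtain ⟨k, hk⟩ := exists_nat_gt (2 * p / (p - 1))
  let b : ContDiffBump (0 : ℝ) := ⟨1 / 4, 1 / 2, by norm_num, by norm_num⟩
  have hb : ContDiff ℝ ∞ b := b.contDiff
  have hb1 : ContDiff ℝ ∞ (deriv b) := (contDiff_infty_iff_deriv.1 hb).2
  have hb2 : ContDiff ℝ ∞ (deriv (deriv b)) := (contDiff_infty_iff_deriv.1 hb1).2
  have hc1 : HasCompactSupport (deriv b) := b.hasCompactSupport.deriv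
  obtain ⟨A1, hA1⟩ := hc1.exists_bound_of_continuous hb1.continuous
  obtain ⟨A2, hA2⟩ := hc1.deriv.exists_bound_of_continuous hb2.continuous
  have hA1p : 0 ≤ A1 := (norm_nonneg _).trans (hA1 0)
  have hA2p : 0 ≤ A2 := (norm_nonneg _).trans (hA2 0)
  have hkp : 2 < (k : ℝ) - k / p := by
    have h1 : 2 * p < k * (p - 1) := by rwa [div_lt_iff₀ (by linarith)] at hk
    have : (k : ℝ) - k / p = k * (p - 1) / p := by field_simp
    rw [this, lt_div_iff₀ (by linarith)]; exact h1
  have hk2 : 2 ≤ k := by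
    have : (0 : ℝ) ≤ k / p := by positivity
    have : (2 : ℝ) < k := by linarith
    exact_mod_cast this.le
  obtain ⟨j, rfl⟩ := Nat.exists_eq_add_of_le hk2
  have hpow : ∀ s, b s ^ j ≤ (b s ^ (2 + j)) ^ (1 / p) := by
    intro s
    have h0 : 0 ≤ b s := b.nonneg
    have h1 : b s ≤ 1 := b.le_one
    rcases h0.eq_or_lt with h | h
    · rw [← h]
      rcases Nat.eq_zero_or_pos j with hj | hj
      · subst hj
        exfalso
        have : (0 : ℝ) < ((2 + 0 : ℕ) : ℝ) / p := by positivity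
        push_cast at *
        linarith
      · rw [zero_pow hj.ne']; positivity
    · rw [← Real.rpow_natCast, ← Real.rpow_natCast, ← Real.rpow_mul h0]
      apply Real.rpow_le_rpow_of_exponent_ge h h1
      push_cast at *
      rw [mul_one_div]; linarith
  -- The sum of the constants for the first and the second derivative; the `+ 1` only secures
  -- positivity.
  refine ⟨(2 + j) * A1 + ((2 + j) * ((1 + j) * A1 ^ 2) + (2 + j) * A2) + 1, by positivity, ?_⟩
  intro T hT
  have hd : ∀ t, HasDerivAt (fun t => b (t * T⁻¹) ^ (2 + j))
      ((2 + j) * b (t * T⁻¹) ^ (1 + j) * (deriv b (t * T⁻¹) * T⁻¹)) t := by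
    intro t
    have h1 : HasDerivAt b (deriv b (t * T⁻¹)) (t * T⁻¹) :=
      (hb.differentiable (by simp) _).hasDerivAt
    have h2 : HasDerivAt (fun t => b (t * T⁻¹)) (deriv b (t * T⁻¹) * T⁻¹) t := by
      simpa using! h1.comp t ((hasDerivAt_id t).mul_const T⁻¹)
    have h3 := h2.fun_pow (2 + j)
    refine h3.congr_deriv ?_
    have : 2 + j - 1 = 1 + j := by omega
    rw [this]; push_cast; ring
  have hd' : deriv (fun t => b (t * T⁻¹) ^ (2 + j)) = fun t =>
      (2 + j) * b (t * T⁻¹) ^ (1 + j) * (deriv b (t * T⁻¹) * T⁻¹) := funext fun t => (hd t).deriv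
  have hdd : ∀ t, HasDerivAt (deriv (fun t => b (t * T⁻¹) ^ (2 + j)))
      (((2 + j) * ((1 + j) * b (t * T⁻¹) ^ j * (deriv b (t * T⁻¹) * T⁻¹))) *
        (deriv b (t * T⁻¹) * T⁻¹) +
        (2 + j) * b (t * T⁻¹) ^ (1 + j) * (deriv (deriv b) (t * T⁻¹) * T⁻¹ * T⁻¹)) t := by
    intro t
    rw [hd']
    have h1 : HasDerivAt b (deriv b (t * T⁻¹)) (t * T⁻¹) :=
      (hb.differentiable (by simp) _).hasDerivAt
    have h1' : HasDerivAt (deriv b) (deriv (deriv b) (t * T⁻¹)) (t * T⁻¹) :=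
      (hb1.differentiable (by simp) _).hasDerivAt
    have h2 : HasDerivAt (fun t => b (t * T⁻¹)) (deriv b (t * T⁻¹) * T⁻¹) t := by
      simpa using! h1.comp t ((hasDerivAt_id t).mul_const T⁻¹)
    have h2' : HasDerivAt (fun t => deriv b (t * T⁻¹)) (deriv (deriv b) (t * T⁻¹) * T⁻¹) t := by
      simpa using! h1'.comp t ((hasDerivAt_id t).mul_const T⁻¹)
    have h3 := ((h2.fun_pow (1 + j)).const_mul ((2 : ℝ) + j)).mul (h2'.mul_const T⁻¹)
    refine h3.congr_deriv ?_
    have : 1 + j - 1 = j := by omega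
    rw [this]; push_cast; ring
  have hone : ∀ s, |s| < 1 / 4 → deriv b s = 0 ∧ deriv (deriv b) s = 0 := by
    intro s hs
    have h1 : (b : ℝ → ℝ) =ᶠ[nhds s] fun _ => 1 := by
      have := b.eventuallyEq_one_of_mem_ball (x := s) (by rw [mem_ball_zero_iff, Real.norm_eq_abs]; exact hs)
      exact this
    have h2 := h1.deriv
    simp only [deriv_const'] at h2
    refine ⟨h2.eq_of_nhds, ?_⟩
    have h3 := h2.deriv
    simp only [deriv_const'] at h3
    exact h3.eq_of_nhds
  have hbase : ∀ t, 0 ≤ b (t * T⁻¹) := fun t => b.nonneg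
  have hle : ∀ t, b (t * T⁻¹) ≤ 1 := fun t => b.le_one
  have hTi : 0 < T⁻¹ := by positivity
  refine ⟨fun t => b (t * T⁻¹) ^ (2 + j), ?_, fun t => pow_nonneg (hbase t) _,
    fun t => pow_le_one₀ (hbase t) (hle t), ?_, ?_, ?_, ?_, ?_, ?_⟩
  · exact (hb.comp (contDiff_id.mul contDiff_const)).pow _
  · have : b (0 : ℝ) = 1 := b.eventuallyEq_one.eq_of_nhds
    simp [this]
  · rw [(hd 0).deriv, (hone (0 * T⁻¹) (by simp)).1]; simp
  · intro t ht
    have : b (t * T⁻¹) = 0 := by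
      apply b.zero_of_le_dist
      rw [dist_zero_right, Real.norm_eq_abs, abs_mul, abs_of_pos hTi, ← div_eq_mul_inv,
        le_div_iff₀ hT]
      show 1 / 2 * T ≤ _
      linarith
    simp [this]
  · intro t h0 ht
    have hs : |t * T⁻¹| < 1 / 4 := by
      rw [abs_of_nonneg (by positivity), ← div_eq_mul_inv, div_lt_iff₀ hT]; linarith
    rw [(hdd t).deriv, (hd t).deriv, (hone _ hs).1, (hone _ hs).2]; simp
  · intro t
    rw [(hd t).deriv]
    have h1 := hA1 (t * T⁻¹)
    rw [Real.norm_eq_abs] at h1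
    rw [abs_mul, abs_mul, abs_mul, abs_of_pos hTi, abs_of_nonneg (pow_nonneg (hbase t) _),
      abs_of_nonneg (by positivity : (0 : ℝ) ≤ 2 + j)]
    have h2 : b (t * T⁻¹) ^ (1 + j) ≤ (b (t * T⁻¹) ^ (2 + j)) ^ (1 / p) :=
      (pow_le_pow_of_le_one (hbase t) (hle t) (by omega)).trans (hpow _)
    set B := (b (t * T⁻¹) ^ (2 + j)) ^ (1 / p)
    have hB0 : 0 ≤ B := (pow_nonneg (hbase t) _).trans h2
    calc _ ≤ (2 + j) * B * (A1 * T⁻¹) := by gcongr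
      _ = ((2 + j) * A1) * T⁻¹ * B := by ring
      _ ≤ _ := by
        refine mul_le_mul_of_nonneg_right (mul_le_mul_of_nonneg_right ?_ hTi.le) hB0
        have : 0 ≤ ((2 + j) * ((1 + j) * A1 ^ 2) + (2 + j) * A2) := by positivity
        linarith
  · intro t
    rw [(hdd t).deriv]
    have h1 := hA1 (t * T⁻¹)
    have h2 := hA2 (t * T⁻¹)
    rw [Real.norm_eq_abs] at h1 h2
    set B := (b (t * T⁻¹) ^ (2 + j)) ^ (1 / p)
    have hB : b (t * T⁻¹) ^ j ≤ B := hpow _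
    have hB1 : b (t * T⁻¹) ^ (1 + j) ≤ B :=
      (pow_le_pow_of_le_one (hbase t) (hle t) (by omega)).trans (hpow _)
    have hB0 : 0 ≤ B := (pow_nonneg (hbase t) _).trans hB
    have hp0 := pow_nonneg (hbase t) j
    have hp1 := pow_nonneg (hbase t) (1 + j)
    calc _ ≤ ((2 + j) * ((1 + j) * B * (A1 * T⁻¹))) * (A1 * T⁻¹) +
        (2 + j) * B * (A2 * T⁻¹ * T⁻¹) := by
          refine (abs_add_le _ _).trans ?_
          simp only [abs_mul, abs_of_pos hTi, abs_of_nonneg hp0, abs_of_nonneg hp1,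
            abs_of_nonneg (by positivity : (0 : ℝ) ≤ 2 + j),
            abs_of_nonneg (by positivity : (0 : ℝ) ≤ 1 + j)]
          gcongr
      _ = ((2 + j) * ((1 + j) * A1 ^ 2) + (2 + j) * A2) * T⁻¹ ^ 2 * B := by ring
      _ ≤ _ := by
        refine mul_le_mul_of_nonneg_right (mul_le_mul_of_nonneg_right ?_ (by positivity)) hB0
        have : 0 ≤ (2 + j) * A1 := by positivity
        linarith

/-! ### Weighted integrals over balls and Hölder's inequality -/

theorem setIntegral_closedBall_norm {n : ℕ} (hn : 0 < n) (F : ℝ → ℝ) {R : ℝ} (hR : 0 ≤ R) :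
    ∫ x in Metric.closedBall (0 : EuclideanSpace ℝ (Fin n)) R, F ‖x‖ =
      (n * volume.real (Metric.ball (0 : EuclideanSpace ℝ (Fin n)) 1)) *
        ∫ y in (0 : ℝ)..R, y ^ (n - 1) * F y := by
  have : Nonempty (Fin n) := ⟨⟨0, hn⟩⟩
  have h1 := integral_fun_norm_addHaar (volume : Measure (EuclideanSpace ℝ (Fin n)))
    (fun y => (Iic R).indicator F y)
  rw [← integral_indicator Metric.isClosed_closedBall.measurableSet]
  have h2 : (Metric.closedBall (0 : EuclideanSpace ℝ (Fin n)) R).indicator (fun x => F ‖x‖) =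
      fun x => (Iic R).indicator F ‖x‖ := by
    ext x; simp [indicator]
  rw [h2, h1, intervalIntegral.integral_of_le hR]
  have h3 : ∫ y in Ioi (0 : ℝ), y ^ (n - 1) • (Iic R).indicator F y =
      ∫ y in Ioc 0 R, y ^ (n - 1) * F y := by
    rw [← integral_indicator measurableSet_Ioi, ← integral_indicator measurableSet_Ioc]
    congr 1; ext y
    by_cases h : 0 < y <;> by_cases h' : y ≤ R <;> simp [indicator, h, h']
  simp only [finrank_euclideanSpace, Fintype.card_fin, h3]
  simp [mul_assoc]

theorem exists_setIntegral_one_add_norm_le {n : ℕ} (hn : 0 < n) {q : ℝ} (hq : q < n) :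
    ∃ C : ℝ, 0 < C ∧ ∀ R : ℝ, 0 ≤ R →
      ∫ x in Metric.closedBall (0 : EuclideanSpace ℝ (Fin n)) R, (1 + ‖x‖) ^ (-q) ≤
        C * (1 + R) ^ (n - q) := by
  set vol := n * volume.real (Metric.ball (0 : EuclideanSpace ℝ (Fin n)) 1)
  have hvol : 0 ≤ vol := by positivity
  have hnq : 0 < n - q := by linarith
  refine ⟨vol / (n - q) + 1, by positivity, fun R hR => ?_⟩
  rw [setIntegral_closedBall_norm hn (fun y => (1 + y) ^ (-q)) hR]
  have hd : ∀ y ∈ uIcc 0 R, HasDerivAt (fun y => (1 + y) ^ (n - q) / (n - q))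
      ((1 + y) ^ (n - q - 1)) y := by
    intro y hy
    rw [uIcc_of_le hR] at hy
    have h := ((hasDerivAt_id y).const_add 1).rpow_const (p := n - q)
      (Or.inl (by simp; linarith [hy.1]))
    have h := h.div_const (n - q)
    refine h.congr_deriv ?_
    simp; field_simp
  have hint : IntervalIntegrable (fun y : ℝ => (1 + y) ^ (n - q - 1)) volume 0 R := by
    apply ContinuousOn.intervalIntegrable
    rw [uIcc_of_le hR]
    apply ContinuousOn.rpow_const (by fun_prop)
    intro x hx; left; linarith [hx.1]
  have hle : ∫ y in (0 : ℝ)..R, y ^ (n - 1) * (1 + y) ^ (-q) ≤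
      ∫ y in (0 : ℝ)..R, (1 + y) ^ (n - q - 1) := by
    apply intervalIntegral.integral_mono_on hR _ hint
    · intro y hy
      have h1 : (0 : ℝ) < 1 + y := by linarith [hy.1]
      have h2 : (1 + y) ^ (n - q - 1) = (1 + y) ^ (n - 1) * (1 + y) ^ (-q) := by
        rw [← Real.rpow_natCast, ← Real.rpow_add h1, Nat.cast_sub hn]
        congr 1; push_cast; ring
      rw [h2]
      have := hy.1
      gcongr; linarith
    · apply ContinuousOn.intervalIntegrable
      rw [uIcc_of_le hR]
      apply ContinuousOn.mul (by fun_prop)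
      apply ContinuousOn.rpow_const (by fun_prop)
      intro x hx; left; linarith [hx.1]
  rw [intervalIntegral.integral_eq_sub_of_hasDerivAt hd hint] at hle
  have h3 : 0 < (1 + R) ^ (n - q) := by positivity
  calc _ ≤ vol * ((1 + R) ^ (n - q) / (n - q)) := by
        gcongr
        refine hle.trans ?_
        have : (0 : ℝ) ≤ (1 + 0) ^ (n - q) / (n - q) := by simp [hnq.le]
        linarith
    _ = vol / (n - q) * (1 + R) ^ (n - q) := by ring
    _ ≤ _ := by gcongr; linarith

theorem one_add_rpow_le_exp {c s : ℝ} (hc : 0 ≤ c) (hs : 0 ≤ s) :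
    (1 + s) ^ c ≤ (2 * c + 1) ^ c * Real.exp (s / 2) := by
  have hN : 0 < 2 * c + 1 := by linarith
  have h1 : 1 + s ≤ (2 * c + 1) * Real.exp (s / (2 * c + 1)) := by
    have := Real.add_one_le_exp (s / (2 * c + 1))
    calc 1 + s ≤ (2 * c + 1) * (s / (2 * c + 1) + 1) := by
          rw [mul_add, mul_div_cancel₀ _ hN.ne']; linarith
      _ ≤ _ := by gcongr
  calc (1 + s) ^ c ≤ ((2 * c + 1) * Real.exp (s / (2 * c + 1))) ^ c := by gcongr
    _ = (2 * c + 1) ^ c * Real.exp (s / (2 * c + 1) * c) := by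
      rw [Real.mul_rpow hN.le (Real.exp_pos _).le, Real.exp_mul]
    _ ≤ _ := by
      gcongr
      rw [div_mul_eq_mul_div, div_le_div_iff₀ hN (by norm_num)]
      nlinarith

/-- The factor `e^(q(|x| - t))` concentrates the integral near the boundary of the ball, where the
weight is comparable to a power of `2 + t`. Integrating out the radial variable therefore gains one
power over the volume count, whence the exponent `n - 1 - m q`. -/
theorem exists_setIntegral_cone_weight_le {n : ℕ} (hn : 0 < n) {m q : ℝ} (hq : 1 ≤ q) :
    ∃ C : ℝ, 0 < C ∧ ∀ t : ℝ, 0 ≤ t →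
      ∫ x in Metric.closedBall (0 : EuclideanSpace ℝ (Fin n)) (t + 1),
        ((1 + ‖x‖) ^ (-m) * Real.exp ‖x‖ * Real.exp (-t)) ^ q ≤
        C * (2 + t) ^ ((n : ℝ) - 1 - m * q) := by
  set vol := n * volume.real (Metric.ball (0 : EuclideanSpace ℝ (Fin n)) 1)
  have hvol : 0 ≤ vol := by positivity
  set b := (n : ℝ) - 1 - m * q
  set K := (2 * |b| + 1) ^ |b|
  have hK : 0 < K := by positivity
  refine ⟨vol * (K * Real.exp q * 2) + 1, by positivity, fun t ht => ?_⟩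
  have hR : 0 ≤ t + 1 := by linarith
  rw [setIntegral_closedBall_norm hn
    (fun y => ((1 + y) ^ (-m) * Real.exp y * Real.exp (-t)) ^ q) hR]
  have hpt : ∀ y ∈ Icc 0 (t + 1), y ^ (n - 1) * ((1 + y) ^ (-m) * Real.exp y * Real.exp (-t)) ^ q ≤
      (2 + t) ^ b * K * Real.exp q * Real.exp ((y - (t + 1)) / 2) := by
    intro y hy
    have h0 := hy.1
    have h1 : 0 < 1 + y := by linarith
    have hs : 0 ≤ t + 1 - y := by linarith [hy.2]
    have e1 : ((1 + y) ^ (-m) * Real.exp y * Real.exp (-t)) ^ q =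
        (1 + y) ^ (-m * q) * Real.exp (q * (y - t)) := by
      rw [mul_assoc, ← Real.exp_add, Real.mul_rpow (by positivity) (by positivity),
        ← Real.rpow_mul h1.le, ← Real.exp_mul]
      congr 2; ring
    have e2 : y ^ (n - 1) * (1 + y) ^ (-m * q) ≤ (1 + y) ^ b := by
      calc _ ≤ (1 + y) ^ (n - 1) * (1 + y) ^ (-m * q) := by gcongr; linarith
        _ = _ := by
          rw [← Real.rpow_natCast, ← Real.rpow_add h1, Nat.cast_sub hn]
          congr 1; push_cast; ring
    -- Moving the power from `1 + y` to `2 + t` costs a power of the distance to the boundary,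
    -- whatever the sign of `b`; half of the exponential decay pays for it.
    have e3 : (1 + y) ^ b ≤ (2 + t) ^ b * (1 + (t + 1 - y)) ^ |b| := by
      have hd : (2 + t) / (1 + y) ≤ 1 + (t + 1 - y) := by
        rw [div_le_iff₀ h1]; nlinarith
      have hd1 : 1 ≤ (2 + t) / (1 + y) := by rw [le_div_iff₀ h1]; linarith
      have : (1 + y) ^ b = (2 + t) ^ b * ((2 + t) / (1 + y)) ^ (-b) := by
        rw [Real.rpow_neg (by positivity), Real.div_rpow (by positivity) h1.le]
        have : (2 + t) ^ b ≠ 0 := by positivity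
        field_simp
      rw [this]
      gcongr
      calc _ ≤ ((2 + t) / (1 + y)) ^ |b| :=
            Real.rpow_le_rpow_of_exponent_le hd1 (neg_le_abs b)
        _ ≤ _ := by gcongr
    have e4 := one_add_rpow_le_exp (abs_nonneg b) hs
    rw [e1, ← mul_assoc]
    calc _ ≤ (2 + t) ^ b * (K * Real.exp ((t + 1 - y) / 2)) * Real.exp (q * (y - t)) := by
          refine mul_le_mul_of_nonneg_right (e2.trans (e3.trans ?_)) (Real.exp_pos _).le
          gcongr
      _ = (2 + t) ^ b * K * Real.exp ((t + 1 - y) / 2 + q * (y - t)) := by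
          rw [Real.exp_add]; ring
      _ ≤ (2 + t) ^ b * K * Real.exp (q + (y - (t + 1)) / 2) := by
          refine mul_le_mul_of_nonneg_left (Real.exp_le_exp.2 ?_) (by positivity)
          nlinarith [mul_nonneg hs (sub_nonneg.2 hq)]
      _ = _ := by rw [Real.exp_add]; ring
  have hle : ∫ y in (0 : ℝ)..(t + 1),
      y ^ (n - 1) * ((1 + y) ^ (-m) * Real.exp y * Real.exp (-t)) ^ q ≤
      ∫ y in (0 : ℝ)..(t + 1), (2 + t) ^ b * K * Real.exp q * Real.exp ((y - (t + 1)) / 2) := by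
    apply intervalIntegral.integral_mono_on hR _ (Continuous.intervalIntegrable (by fun_prop) _ _)
      hpt
    apply ContinuousOn.intervalIntegrable
    rw [uIcc_of_le hR]
    apply ContinuousOn.mul (by fun_prop)
    apply ContinuousOn.rpow_const _ (fun x hx => Or.inr (by linarith))
    apply ContinuousOn.mul _ (by fun_prop)
    apply ContinuousOn.mul _ (by fun_prop)
    apply ContinuousOn.rpow_const (by fun_prop)
    intro x hx; left; linarith [hx.1]
  have hI : ∫ y in (0 : ℝ)..(t + 1), Real.exp ((y - (t + 1)) / 2) ≤ 2 := by
    have hd : ∀ y ∈ uIcc 0 (t + 1), HasDerivAt (fun y => 2 * Real.exp ((y - (t + 1)) / 2))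
        (Real.exp ((y - (t + 1)) / 2)) y := by
      intro y _
      have h := ((((hasDerivAt_id y).sub_const (t + 1)).div_const 2).exp).const_mul 2
      refine h.congr_deriv ?_; simp; ring
    rw [intervalIntegral.integral_eq_sub_of_hasDerivAt hd
      (Continuous.intervalIntegrable (by fun_prop) _ _)]
    have := Real.exp_pos ((0 - (t + 1)) / 2)
    simp only [sub_self, zero_div, Real.exp_zero]; linarith
  rw [intervalIntegral.integral_const_mul] at hle
  calc _ ≤ vol * ((2 + t) ^ b * K * Real.exp q * 2) := by
        gcongr
        exact hle.trans (by gcongr)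
    _ = vol * (K * Real.exp q * 2) * (2 + t) ^ b := by ring
    _ ≤ _ := by gcongr; linarith

theorem abs_integral_mul_le_of_support_closedBall {n : ℕ} {v w W : EuclideanSpace ℝ (Fin n) → ℝ}
    {p q R : ℝ} (hpq : p.HolderConjugate q) (hv : AEStronglyMeasurable v volume)
    (hvp : Integrable (fun x => |v x| ^ p)) (hsupp : ∀ᵐ x, R < ‖x‖ → v x = 0)
    (hW : Continuous W) (hwW : ∀ x, ‖x‖ ≤ R → |w x| ≤ W x) :
    |∫ x, v x * w x| ≤ (∫ x, |v x| ^ p) ^ (1 / p) *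
      (∫ x in Metric.closedBall 0 R, W x ^ q) ^ (1 / q) := by
  set B := Metric.closedBall (0 : EuclideanSpace ℝ (Fin n)) R with hB
  have hBm : MeasurableSet B := Metric.isClosed_closedBall.measurableSet
  have hp0 : 0 < p := hpq.pos
  have hq0 : 0 < q := hpq.symm.pos
  have hfin : IsFiniteMeasure (volume.restrict B) :=
    ⟨by simpa using (isCompact_closedBall (0 : EuclideanSpace ℝ (Fin n)) R).measure_lt_top⟩
  have hvL : MemLp (fun x => |v x|) (ENNReal.ofReal p) (volume.restrict B) := by
    have : MemLp v (ENNReal.ofReal p) volume := by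
      rw [← integrable_norm_rpow_iff hv (by simpa using hp0) ENNReal.ofReal_ne_top,
        ENNReal.toReal_ofReal hp0.le]
      simpa [Real.norm_eq_abs] using hvp
    exact this.norm.restrict B
  have hWL : MemLp (B.indicator W) (ENNReal.ofReal q) (volume.restrict B) := by
    obtain ⟨C, hC⟩ := (isCompact_closedBall (0 : EuclideanSpace ℝ (Fin n)) R).exists_bound_of_continuousOn
      hW.continuousOn
    refine MemLp.of_bound (hW.aestronglyMeasurable.indicator hBm) C ?_
    filter_upwards [ae_restrict_mem hBm] with x hx
    rw [indicator_of_mem hx]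
    exact hC x hx
  have hpos : ∀ x ∈ B, 0 ≤ W x := fun x hx =>
    (abs_nonneg _).trans (hwW x (by simpa [hB] using hx))
  have hint : Integrable (fun x => |v x| * B.indicator W x) (volume.restrict B) :=
    have := hpq.ennrealOfReal
    MemLp.integrable_mul (p := ENNReal.ofReal p) (q := ENNReal.ofReal q) hvL hWL
  have hH := integral_mul_le_Lp_mul_Lq_of_nonneg hpq (μ := volume.restrict B)
    (f := fun x => |v x|) (g := B.indicator W)
    (Filter.Eventually.of_forall fun x => abs_nonneg _)
    (Filter.Eventually.of_forall fun x => indicator_nonneg hpos x) hvL hWL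
  have h1 : |∫ x, v x * w x| ≤ ∫ x in B, |v x| * B.indicator W x := by
    have e : ∫ x, v x * w x = ∫ x in B, v x * w x := by
      rw [← integral_indicator hBm]
      apply integral_congr_ae
      filter_upwards [hsupp] with x hx
      by_cases h : x ∈ B
      · rw [indicator_of_mem h]
      · rw [indicator_of_notMem h, hx (by simpa [hB] using h), zero_mul]
    rw [e]
    rw [← Real.norm_eq_abs]
    refine norm_integral_le_of_norm_le hint ?_
    filter_upwards [ae_restrict_mem hBm] with x hx
    rw [indicator_of_mem hx, Real.norm_eq_abs, abs_mul]
    exact mul_le_mul_of_nonneg_left (hwW x (by simpa [hB] using hx)) (abs_nonneg _)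
  refine h1.trans (hH.trans ?_)
  have h2 : ∫ x in B, B.indicator W x ^ q = ∫ x in B, W x ^ q :=
    setIntegral_congr_fun hBm fun x hx => by simp only [indicator_of_mem hx]
  rw [h2]
  have h3 : 0 ≤ ∫ x in B, W x ^ q :=
    setIntegral_nonneg hBm fun x hx => Real.rpow_nonneg (hpos x hx) _
  refine mul_le_mul_of_nonneg_right ?_ (Real.rpow_nonneg h3 _)
  refine Real.rpow_le_rpow (integral_nonneg fun x => by positivity) ?_ (by positivity)
  exact setIntegral_le_integral hvp (Filter.Eventually.of_forall fun x => by positivity)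

/-! ### The radial equation: existence and growth of a positive solution -/

/-- The radial average `s ↦ ∫₀¹ θⁿ⁻¹ F(sθ) dθ`. -/
noncomputable def radialAverage (n : ℕ) (F : ℝ → ℝ) (s : ℝ) : ℝ :=
  ∫ θ in (0 : ℝ)..1, θ ^ (n - 1) * F (s * θ)

/-- The inverse of the radial Laplacian in dimension `n`, vanishing at the origin. -/
noncomputable def radialInverse (n : ℕ) (F : ℝ → ℝ) (r : ℝ) : ℝ :=
  ∫ s in (0 : ℝ)..r, s * radialAverage n F s

theorem continuous_radialAverage {n : ℕ} {F : ℝ → ℝ} (hF : Continuous F) :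
    Continuous (radialAverage n F) := by
  apply intervalIntegral.continuous_parametric_intervalIntegral_of_continuous'
  exact ((continuous_snd.pow _).mul (hF.comp (continuous_fst.mul continuous_snd)))

theorem hasDerivAt_radialInverse {n : ℕ} {F : ℝ → ℝ} (hF : Continuous F) (r : ℝ) :
    HasDerivAt (radialInverse n F) (r * radialAverage n F r) r :=
  intervalIntegral.integral_hasDerivAt_right
    ((continuous_id.mul (continuous_radialAverage hF)).intervalIntegrable _ _)
    ((continuous_id.mul (continuous_radialAverage hF)).stronglyMeasurableAtFilter _ _)
    (continuous_id.mul (continuous_radialAverage hF)).continuousAt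

theorem pow_mul_radialAverage {n : ℕ} (hn : 0 < n) (F : ℝ → ℝ) (r : ℝ) :
    r ^ n * radialAverage n F r = ∫ τ in (0 : ℝ)..r, τ ^ (n - 1) * F τ := by
  have := intervalIntegral.mul_integral_comp_mul_left (a := 0) (b := 1)
    (f := fun τ => τ ^ (n - 1) * F τ) r
  simp only [mul_zero, mul_one] at this
  rw [← this, radialAverage]
  obtain ⟨k, rfl⟩ := Nat.exists_eq_succ_of_ne_zero hn.ne'
  rw [Nat.succ_eq_add_one, pow_succ, mul_comm _ r, mul_assoc, ← intervalIntegral.integral_const_mul]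
  congr 2
  ext x
  simp only [Nat.add_sub_cancel]
  ring

/-- With `y = r * radialAverage n F r`, this is the radial Poisson equation `y' + (n - 1) y / r = F`
for the derivative `y` of `radialInverse n F`. It holds because `r^(n-1) y` is the primitive of
`τ^(n-1) F`. -/
theorem hasDerivAt_mul_radialAverage {n : ℕ} (hn : 0 < n) {F : ℝ → ℝ} (hF : Continuous F)
    {r : ℝ} (hr : 0 < r) :
    HasDerivAt (fun r => r * radialAverage n F r)
      (F r - (n - 1) * (r * radialAverage n F r) / r) r := by
  have hc : Continuous fun τ : ℝ => τ ^ (n - 1) * F τ := (continuous_pow _).mul hF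
  have h1 : HasDerivAt (fun r => ∫ τ in (0 : ℝ)..r, τ ^ (n - 1) * F τ) (r ^ (n - 1) * F r) r :=
    intervalIntegral.integral_hasDerivAt_right (hc.intervalIntegrable _ _)
      (hc.stronglyMeasurableAtFilter _ _) hc.continuousAt
  have h2 := h1.div (hasDerivAt_pow (n - 1) r) (pow_ne_zero _ hr.ne')
  obtain ⟨k, rfl⟩ := Nat.exists_eq_succ_of_ne_zero hn.ne'
  have h3 : (fun r => r * radialAverage (k + 1) F r) =ᶠ[nhds r]
      fun r => (∫ τ in (0 : ℝ)..r, τ ^ k * F τ) / r ^ k := by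
    filter_upwards [lt_mem_nhds hr] with s hs
    have := pow_mul_radialAverage hn F s
    simp only [Nat.succ_eq_add_one, Nat.add_sub_cancel] at this
    rw [← this, pow_succ]
    field_simp
  refine (HasDerivAt.congr_of_eventuallyEq h2 h3).congr_deriv ?_
  have := pow_mul_radialAverage hn F r
  simp only [Nat.succ_eq_add_one, Nat.add_sub_cancel] at this ⊢
  rw [← this]
  push_cast
  rcases Nat.eq_zero_or_pos k with h | h
  · subst h; simp
  · obtain ⟨j, rfl⟩ := Nat.exists_eq_succ_of_ne_zero h.ne'
    simp only [Nat.succ_eq_add_one, Nat.add_sub_cancel]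
    field_simp
    push_cast
    ring

theorem abs_radialAverage_le {n : ℕ} {F : ℝ → ℝ} {B s : ℝ}
    (hB : ∀ θ ∈ Icc (0 : ℝ) 1, |F (s * θ)| ≤ B) : |radialAverage n F s| ≤ B := by
  have := intervalIntegral.norm_integral_le_of_norm_le_const (a := 0) (b := 1) (C := B)
    (f := fun θ => θ ^ (n - 1) * F (s * θ)) ?_
  · simpa [radialAverage] using this
  · intro θ hθ
    rw [uIoc_of_le zero_le_one] at hθ
    have h1 := hB θ ⟨hθ.1.le, hθ.2⟩
    rw [norm_mul, Real.norm_eq_abs, Real.norm_eq_abs, abs_of_nonneg (pow_nonneg hθ.1.le _)]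
    calc _ ≤ 1 * |F (s * θ)| := by
          gcongr; exact pow_le_one₀ hθ.1.le hθ.2
      _ ≤ B := by linarith

theorem abs_radialInverse_le {n : ℕ} {F : ℝ → ℝ} {B R r : ℝ} (hr : r ∈ Icc 0 R)
    (hB : ∀ s ∈ Icc 0 R, |F s| ≤ B) : |radialInverse n F r| ≤ B * R ^ 2 := by
  have hB0 : 0 ≤ B := (abs_nonneg _).trans (hB r hr)
  have hR : 0 ≤ R := hr.1.trans hr.2
  have := intervalIntegral.norm_integral_le_of_norm_le_const (a := 0) (b := r) (C := R * B)
    (f := fun s => s * radialAverage n F s) ?_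
  · rw [sub_zero, abs_of_nonneg hr.1] at this
    refine this.trans ?_
    calc _ ≤ R * B * R := by gcongr; exact hr.2
      _ = _ := by ring
  · intro s hs
    rw [uIoc_of_le hr.1] at hs
    rw [norm_mul, Real.norm_eq_abs, abs_of_pos hs.1]
    have h2 : s ≤ R := hs.2.trans hr.2
    gcongr
    refine abs_radialAverage_le fun θ hθ => hB _ ⟨mul_nonneg hs.1.le hθ.1, ?_⟩
    calc s * θ ≤ s * 1 := by gcongr; exacts [hs.1.le, hθ.2]
      _ ≤ R := by linarith

theorem radialAverage_nonneg {n : ℕ} {F : ℝ → ℝ} (hF : ∀ s, 0 ≤ F s) (s : ℝ) :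
    0 ≤ radialAverage n F s :=
  intervalIntegral.integral_nonneg zero_le_one fun _ hθ =>
    mul_nonneg (pow_nonneg hθ.1 _) (hF _)

theorem radialInverse_eq_mul_integral {n : ℕ} (F : ℝ → ℝ) (r : ℝ) :
    radialInverse n F r = r * ∫ σ in (0 : ℝ)..1, (r * σ) * radialAverage n F (r * σ) := by
  have := intervalIntegral.mul_integral_comp_mul_left (a := 0) (b := 1)
    (f := fun s => s * radialAverage n F s) r
  simp only [mul_zero, mul_one] at this
  rw [this, radialInverse]

theorem radialInverse_nonneg {n : ℕ} {F : ℝ → ℝ} (hF : ∀ s, 0 ≤ F s) (r : ℝ) :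
    0 ≤ radialInverse n F r := by
  rw [radialInverse_eq_mul_integral, ← intervalIntegral.integral_const_mul]
  refine intervalIntegral.integral_nonneg zero_le_one fun σ hσ => ?_
  have := radialAverage_nonneg (n := n) hF (r * σ)
  have := hσ.1
  rw [← mul_assoc, show r * (r * σ) = r ^ 2 * σ by ring]
  positivity

theorem radialAverage_sub {n : ℕ} {F G : ℝ → ℝ} (hF : Continuous F) (hG : Continuous G) (s : ℝ) :
    radialAverage n (fun r => F r - G r) s = radialAverage n F s - radialAverage n G s := by
  unfold radialAverage
  rw [← intervalIntegral.integral_sub]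
  · simp only [mul_sub]
  all_goals
    apply Continuous.intervalIntegrable
    fun_prop

theorem radialInverse_sub {n : ℕ} {F G : ℝ → ℝ} (hF : Continuous F) (hG : Continuous G) (r : ℝ) :
    radialInverse n (fun r => F r - G r) r = radialInverse n F r - radialInverse n G r := by
  unfold radialInverse
  rw [← intervalIntegral.integral_sub]
  · simp only [radialAverage_sub hF hG, mul_sub]
  · exact (continuous_id.mul (continuous_radialAverage hF)).intervalIntegrable _ _
  · exact (continuous_id.mul (continuous_radialAverage hG)).intervalIntegrable _ _

/-- Averaging preserves the Gaussian bound since `|sθ| ≤ |s|`, and integrating `s e^(a s²)` gains `1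
/ (2a)`. This gain gives a contraction on the whole line at once. -/
theorem abs_radialInverse_le_exp {n : ℕ} {F : ℝ → ℝ} {a B : ℝ} (ha : 0 < a)
    (hB : ∀ s, |F s| ≤ B * Real.exp (a * s ^ 2)) (r : ℝ) :
    |radialInverse n F r| ≤ B / (2 * a) * Real.exp (a * r ^ 2) := by
  have hB0 : 0 ≤ B := by
    have := (abs_nonneg _).trans (hB 0); simpa using this
  rw [radialInverse_eq_mul_integral, ← intervalIntegral.integral_const_mul]
  have hd : ∀ σ ∈ uIcc (0 : ℝ) 1, HasDerivAt (fun σ => B / (2 * a) * Real.exp (a * (r * σ) ^ 2))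
      (r ^ 2 * σ * (B * Real.exp (a * (r * σ) ^ 2))) σ := by
    intro σ _
    have h := ((((((hasDerivAt_id σ).const_mul r).fun_pow 2).const_mul a).exp).const_mul
      (B / (2 * a)))
    refine h.congr_deriv ?_
    simp; field_simp
  have hle := intervalIntegral.norm_integral_le_of_norm_le (a := (0 : ℝ)) (b := 1) zero_le_one
    (f := fun σ => r * (r * σ * radialAverage n F (r * σ)))
    (g := fun σ => r ^ 2 * σ * (B * Real.exp (a * (r * σ) ^ 2)))
    (μ := volume) (Filter.Eventually.of_forall fun σ hσ => ?_)
    (Continuous.intervalIntegrable (by fun_prop) _ _)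
  · rw [intervalIntegral.integral_eq_sub_of_hasDerivAt hd
      (Continuous.intervalIntegrable (by fun_prop) _ _)] at hle
    refine hle.trans ?_
    simp only [mul_one, mul_zero]
    have : 0 ≤ B / (2 * a) * Real.exp (a * 0 ^ 2) := by positivity
    linarith
  · have hσ0 := hσ.1.le
    have h1 : |radialAverage n F (r * σ)| ≤ B * Real.exp (a * (r * σ) ^ 2) := by
      refine abs_radialAverage_le fun θ hθ => (hB _).trans ?_
      have : (r * σ * θ) ^ 2 ≤ (r * σ) ^ 2 := by
        rw [mul_pow (r * σ)]
        have : θ ^ 2 ≤ 1 := pow_le_one₀ hθ.1 hθ.2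
        nlinarith [sq_nonneg (r * σ)]
      gcongr
    rw [← mul_assoc, show r * (r * σ) = r ^ 2 * σ by ring, norm_mul, Real.norm_eq_abs,
      Real.norm_eq_abs, abs_of_nonneg (by positivity)]
    gcongr

/-- Contraction principle in the sup norm weighted by `e^(-M r²)`, where the contraction factor is
`M / (2M) = 1/2`. The positivity of the integral operator gives `h ≥ 1`. -/
theorem exists_radial_fixedPoint (n : ℕ) {W : ℝ → ℝ} (hW : Continuous W) {M : ℝ} (hM : 0 < M)
    (hW0 : ∀ s, 0 ≤ W s) (hWM : ∀ s, W s ≤ M) :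
    ∃ h : ℝ → ℝ, Continuous h ∧ (∀ r, 1 ≤ h r) ∧
      ∀ r, h r = 1 + radialInverse n (fun s => W s * h s) r := by
  let E : ℝ → ℝ := fun s => Real.exp (M * s ^ 2)
  have hE : Continuous E := by fun_prop
  -- The integral equation rewritten for `v = e^(-M r²) h`, which is sought among the bounded
  -- continuous functions.
  let Op : (ℝ → ℝ) → ℝ → ℝ := fun v r =>
    Real.exp (-(M * r ^ 2)) * (1 + radialInverse n (fun s => W s * (E s * v s)) r)
  have hc : ∀ v : ℝ → ℝ, Continuous v → Continuous fun s => W s * (E s * v s) := by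
    intro v hv; fun_prop
  have hcont : ∀ v : ℝ → ℝ, Continuous v → Continuous (Op v) := by
    intro v hv
    have : Continuous (radialInverse n (fun s => W s * (E s * v s))) :=
      continuous_iff_continuousAt.2 fun r => (hasDerivAt_radialInverse (hc v hv) r).continuousAt
    fun_prop
  have hEE : ∀ r : ℝ, Real.exp (-(M * r ^ 2)) * E r = 1 := fun r => by
    rw [← Real.exp_add]; simp
  have hbd : ∀ (v : ℝ → ℝ) (B : ℝ), Continuous v → (∀ s, |v s| ≤ B) → ∀ r,
      Real.exp (-(M * r ^ 2)) * |radialInverse n (fun s => W s * (E s * v s)) r| ≤ 1 / 2 * B := by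
    intro v B hv hB r
    have h1 := abs_radialInverse_le_exp (n := n)
      (F := fun s => W s * (E s * v s)) hM (B := M * B) (fun s => by
      rw [abs_mul, abs_mul, abs_of_nonneg (hW0 s), abs_of_pos (Real.exp_pos _)]
      calc _ ≤ M * (E s * B) := by
            gcongr
            · exact hWM s
            · exact hB s
        _ = _ := by ring) r
    calc _ ≤ Real.exp (-(M * r ^ 2)) * (M * B / (2 * M) * Real.exp (M * r ^ 2)) := by gcongr
      _ = (Real.exp (-(M * r ^ 2)) * E r) * (M * B / (2 * M)) := by ring
      _ = _ := by rw [hEE]; field_simp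
  have hexp1 : ∀ r : ℝ, Real.exp (-(M * r ^ 2)) ≤ 1 := fun r => by
    rw [Real.exp_le_one_iff]; have := sq_nonneg r; nlinarith
  let Φ : BoundedContinuousFunction ℝ ℝ → BoundedContinuousFunction ℝ ℝ := fun v =>
    BoundedContinuousFunction.ofNormedAddCommGroup (Op v) (hcont v v.continuous) (1 + 1 / 2 * ‖v‖)
      (fun r => by
        have h1 := hbd v ‖v‖ v.continuous (fun s => v.norm_coe_le_norm s) r
        rw [Real.norm_eq_abs, abs_mul, abs_of_pos (Real.exp_pos _)]
        calc _ ≤ Real.exp (-(M * r ^ 2)) *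
              (1 + |radialInverse n (fun s => W s * (E s * v s)) r|) := by
              gcongr
              refine (abs_add_le _ _).trans ?_
              simp
          _ ≤ _ := by rw [mul_add, mul_one]; linarith [hexp1 r])
  have hΦ : ContractingWith (1 / 2) Φ := by
    refine ⟨by rw [← NNReal.coe_lt_coe]; norm_num, LipschitzWith.of_dist_le_mul fun v w => ?_⟩
    rw [BoundedContinuousFunction.dist_le (by positivity)]
    intro r
    have h1 := hbd (fun s => v s - w s) (dist v w) (by fun_prop)
      (fun s => by rw [← Real.dist_eq]; exact BoundedContinuousFunction.dist_coe_le_dist s) r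
    show dist (Op v r) (Op w r) ≤ _
    have h2 : Op v r - Op w r = Real.exp (-(M * r ^ 2)) *
        radialInverse n (fun s => W s * (E s * (v s - w s))) r := by
      have := radialInverse_sub (n := n) (hc v v.continuous) (hc w w.continuous) r
      have e : (fun s => W s * (E s * (v s - w s))) =
        fun s => W s * (E s * v s) - W s * (E s * w s) := by ext s; ring
      rw [e, this]
      simp only [Op]; ring
    rw [Real.dist_eq, h2, abs_mul, abs_of_pos (Real.exp_pos _)]
    refine h1.trans (le_of_eq ?_)
    norm_num
  set v := ContractingWith.fixedPoint Φ hΦ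
  have hfix : Φ v = v := hΦ.fixedPoint_isFixedPt
  have hnn : ∀ r, 0 ≤ v r := by
    -- Nonnegativity passes from the iterates starting at `0` to their limit.
    have h0 : ∀ k r, 0 ≤ (Φ^[k] 0) r := by
      intro k
      induction k with
      | zero => intro r; simp
      | succ k ih =>
        intro r
        rw [Function.iterate_succ_apply']
        have := radialInverse_nonneg (n := n) (F := fun s => W s * (E s * (Φ^[k] 0) s))
          (fun s => mul_nonneg (hW0 s) (mul_nonneg (Real.exp_pos _).le (ih s))) r
        show 0 ≤ Real.exp (-(M * r ^ 2)) * (1 + _)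
        positivity
    intro r
    have ht := hΦ.tendsto_iterate_fixedPoint (0 : BoundedContinuousFunction ℝ ℝ)
    have ht' := ((BoundedContinuousFunction.evalCLM ℝ r).continuous.tendsto _).comp ht
    exact ge_of_tendsto' ht' fun k => h0 k r
  have hh : ∀ r, E r * v r = 1 + radialInverse n (fun s => W s * (E s * v s)) r := by
    intro r
    have h1 : Op v r = v r := by
      have := congrArg (fun w : BoundedContinuousFunction ℝ ℝ => w r) hfix
      exact this
    rw [← h1]
    simp only [Op]
    rw [← mul_assoc, mul_comm (E r), hEE, one_mul]
  refine ⟨fun s => E s * v s, by fun_prop, fun r => ?_, hh⟩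
  have := hh r
  have := radialInverse_nonneg (n := n) (F := fun s => W s * (E s * v s))
    (fun s => mul_nonneg (hW0 s) (mul_nonneg (Real.exp_pos _).le (hnn s))) r
  show 1 ≤ E r * v r
  linarith

/-- With `m = (n-1)/2`, the function `w = r^m h` satisfies `w'' = (W + (m² - m)/r²) w`, with no
first-order term. The potential differs from `1` by at most a multiple of `r⁻²`, which is integrable
at infinity, so `w` grows at most like `e^r` with no polynomial loss. -/
theorem radial_fixedPoint_growth {n : ℕ} (hn : 0 < n) {W h : ℝ → ℝ} (hW : Continuous W)
    (hh : Continuous h) (hW0 : ∀ s, 0 ≤ W s) {μ : ℝ} (hμ : 0 ≤ μ)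
    (hWμ : ∀ r, 1 ≤ r → W r ≤ 1 + μ / r ^ 2) (h1 : ∀ r, 1 ≤ h r)
    (heq : ∀ r, h r = 1 + radialInverse n (fun s => W s * h s) r) :
    ∃ K : ℝ, 0 < K ∧
      ∀ r, 0 ≤ r → h r ≤ K * ((1 + r) ^ (-(((n : ℝ) - 1) / 2)) * Real.exp r) := by
  set m := ((n : ℝ) - 1) / 2 with hm
  have hn1 : (1 : ℝ) ≤ n := by exact_mod_cast hn
  have hm0 : 0 ≤ m := by linarith
  have hWh : Continuous fun s => W s * h s := hW.mul hh
  set y : ℝ → ℝ := fun r => r * radialAverage n (fun s => W s * h s) r with hy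
  have hy0 : ∀ r, 0 ≤ r → 0 ≤ y r := fun r hr => mul_nonneg hr
    (radialAverage_nonneg (fun s => mul_nonneg (hW0 s) (zero_le_one.trans (h1 s))) r)
  have hdh : ∀ r, HasDerivAt h (y r) r := by
    intro r
    have := (hasDerivAt_radialInverse (n := n) hWh r).const_add 1
    exact this.congr_of_eventuallyEq (Filter.Eventually.of_forall heq)
  have hdy : ∀ r, 0 < r → HasDerivAt y (W r * h r - 2 * m * y r / r) r := by
    intro r hr
    refine (hasDerivAt_mul_radialAverage hn hWh hr).congr_deriv ?_
    rw [hm]; ring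
  -- Chosen so that `W - 1 + (m² - m)/r² ≤ c / r²` for `r ≥ 1`.
  set c := μ + m ^ 2 with hc
  -- This is `w' + w` for `w = r^m h`. It dominates `w` and satisfies `z' = z + w'' - w`.
  set z : ℝ → ℝ := fun r => r ^ m * (y r + (1 + m / r) * h r) with hz
  have hdz : ∀ r, 0 < r → HasDerivAt z
      (z r + r ^ m * h r * (W r - 1 + (m ^ 2 - m) / r ^ 2)) r := by
    intro r hr
    have e1 : HasDerivAt (fun r : ℝ => r ^ m) (m * r ^ (m - 1)) r :=
      Real.hasDerivAt_rpow_const (Or.inl hr.ne')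
    have e2 : HasDerivAt (fun r : ℝ => 1 + m / r) (-m / r ^ 2) r := by
      have := ((hasDerivAt_inv hr.ne').const_mul m).const_add 1
      refine (this.congr_of_eventuallyEq ?_).congr_deriv ?_
      · exact Filter.Eventually.of_forall fun s => by simp [div_eq_mul_inv]
      · field_simp
    have e3 := e1.mul ((hdy r hr).add (e2.mul (hdh r)))
    refine HasDerivAt.congr_deriv e3 ?_
    rw [Real.rpow_sub_one hr.ne']
    simp only [hz, Pi.add_apply, Pi.mul_apply]
    field_simp
    ring
  have hhz : ∀ r, 0 < r → r ^ m * h r ≤ z r := by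
    intro r hr
    have := hy0 r hr.le
    have h2 : 0 ≤ m / r * h r :=
      mul_nonneg (by positivity) (zero_le_one.trans (h1 r))
    simp only [hz]
    gcongr
    linarith
  -- The factor `e^(-r)` removes the main growth, and `e^(c/r)`, bounded on `r ≥ 1`, absorbs the
  -- error, so `ψ` decreases there.
  set ψ : ℝ → ℝ := fun r => z r * Real.exp (-r + c / r) with hψ
  have hdψ : ∀ r, 0 < r → HasDerivAt ψ
      ((r ^ m * h r * (W r - 1 + (m ^ 2 - m) / r ^ 2) - c / r ^ 2 * z r) *
        Real.exp (-r + c / r)) r := by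
    intro r hr
    have e2 : HasDerivAt (fun r : ℝ => -r + c / r) (-1 + -c / r ^ 2) r := by
      have := (hasDerivAt_id r).neg.add ((hasDerivAt_inv hr.ne').const_mul c)
      refine (this.congr_of_eventuallyEq ?_).congr_deriv ?_
      · exact Filter.Eventually.of_forall fun s => by simp [div_eq_mul_inv]
      · field_simp
    refine ((hdz r hr).mul e2.exp).congr_deriv ?_
    ring
  have hanti : AntitoneOn ψ (Ici 1) := by
    apply antitoneOn_of_deriv_nonpos (convex_Ici 1)
    · exact fun r hr => (hdψ r (zero_lt_one.trans_le hr)).continuousAt.continuousWithinAt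
    · intro r hr
      rw [interior_Ici] at hr
      exact (hdψ r (zero_lt_one.trans hr)).differentiableAt.differentiableWithinAt
    · intro r hr
      rw [interior_Ici] at hr
      have hr1 : 1 < r := hr
      have hr0 : 0 < r := zero_lt_one.trans hr
      rw [(hdψ r hr0).deriv]
      refine mul_nonpos_of_nonpos_of_nonneg ?_ (Real.exp_pos _).le
      have a1 : W r - 1 + (m ^ 2 - m) / r ^ 2 ≤ c / r ^ 2 := by
        have a2 := hWμ r hr1.le
        have a3 : c / r ^ 2 = μ / r ^ 2 + (m ^ 2 - m) / r ^ 2 + m / r ^ 2 := by rw [hc]; ring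
        have a4 : 0 ≤ m / r ^ 2 := by positivity
        linarith
      have a5 : 0 ≤ r ^ m * h r := mul_nonneg (by positivity) (zero_le_one.trans (h1 r))
      have a6 : 0 ≤ c / r ^ 2 := by positivity
      calc _ ≤ r ^ m * h r * (c / r ^ 2) - c / r ^ 2 * (r ^ m * h r) := by
            gcongr
            exact hhz r hr0
        _ = 0 := by ring
  obtain ⟨H, hH⟩ := isCompact_Icc.exists_bound_of_continuousOn (s := Icc (0 : ℝ) 1)
    hh.continuousOn
  have hH0 : 0 ≤ H := (norm_nonneg _).trans (hH 0 (by simp))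
  have hψ1 : 0 < ψ 1 :=
    mul_pos ((mul_pos (by positivity) (zero_lt_one.trans_le (h1 1))).trans_le
      (hhz 1 zero_lt_one)) (Real.exp_pos _)
  -- Here `ψ 1` serves `r ≥ 1` and `H` serves `[0, 1]`; `2^m` comes from `1 + r ≤ 2r` in the former
  -- range and from `1 + r ≤ 2` in the latter.
  refine ⟨2 ^ m * (ψ 1 + H), by positivity, fun r hr => ?_⟩
  rcases le_total 1 r with hr1 | hr1
  · have hr0 : 0 < r := zero_lt_one.trans_le hr1
    have b1 : ψ r ≤ ψ 1 := hanti (mem_Ici.2 le_rfl) (mem_Ici.2 hr1) hr1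
    have b2 : r ^ m * h r ≤ ψ 1 * Real.exp r := by
      have b3 : z r = ψ r * Real.exp (r - c / r) := by
        simp only [hψ]
        rw [mul_assoc, ← Real.exp_add]
        simp
      have b4 : 0 ≤ c / r := by positivity
      calc _ ≤ z r := hhz r hr0
        _ = ψ r * Real.exp (r - c / r) := b3
        _ ≤ _ := by
          gcongr
          linarith
    have b5 : h r ≤ r ^ (-m) * (ψ 1 * Real.exp r) := by
      rw [Real.rpow_neg hr, ← div_eq_inv_mul, le_div_iff₀ (by positivity)]
      linarith
    have b6 : r ^ (-m) ≤ 2 ^ m * (1 + r) ^ (-m) := by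
      have : (2 : ℝ) ^ m = (2⁻¹ : ℝ) ^ (-m) := by
        rw [Real.inv_rpow (by norm_num), Real.rpow_neg (by norm_num), inv_inv]
      rw [this, ← Real.mul_rpow (by norm_num) (by linarith)]
      exact Real.rpow_le_rpow_of_nonpos (by linarith) (by linarith) (by linarith)
    calc h r ≤ (2 ^ m * (1 + r) ^ (-m)) * (ψ 1 * Real.exp r) := b5.trans (by gcongr)
      _ = 2 ^ m * ψ 1 * ((1 + r) ^ (-m) * Real.exp r) := by ring
      _ ≤ _ := by gcongr; linarith
  · have b1 : h r ≤ H := (le_abs_self _).trans (hH r ⟨hr, hr1⟩)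
    have b2 : (1 : ℝ) ≤ 2 ^ m * ((1 + r) ^ (-m) * Real.exp r) := by
      have b3 : (2 : ℝ) ^ (-m) ≤ (1 + r) ^ (-m) :=
        Real.rpow_le_rpow_of_nonpos (by linarith) (by linarith) (by linarith)
      have b4 : 1 ≤ Real.exp r := Real.one_le_exp hr
      calc (1 : ℝ) = 2 ^ m * (2 ^ (-m) * 1) := by
            rw [mul_one, ← Real.rpow_add (by norm_num)]; simp
        _ ≤ _ := by gcongr
    calc h r ≤ H * 1 := by linarith
      _ ≤ (ψ 1 + H) * (2 ^ m * ((1 + r) ^ (-m) * Real.exp r)) := by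
        gcongr; linarith
      _ = _ := by ring

/-! ### The Laplacian and smooth approximation of radial solutions -/

/-- Polynomials in `r²` are stable under the inverse radial Laplacian, and such polynomials in `|x|`
are smooth on `ℝⁿ`. The second clause is the radial Laplace equation in the variable `s = r²`. -/
theorem radialInverse_polynomial {n : ℕ} (hn : 0 < n) (P : Polynomial ℝ) :
    ∃ Q : Polynomial ℝ, (∀ r, Q.eval (r ^ 2) = radialInverse n (fun s => P.eval (s ^ 2)) r) ∧
      ∀ s, 4 * s * Q.derivative.derivative.eval s + 2 * n * Q.derivative.eval s = P.eval s := by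
  induction P using Polynomial.induction_on' with
  | add P₁ P₂ h₁ h₂ =>
    obtain ⟨Q₁, h₁, h₁'⟩ := h₁
    obtain ⟨Q₂, h₂, h₂'⟩ := h₂
    refine ⟨Q₁ + Q₂, fun r => ?_, fun s => ?_⟩
    · have hc₁ : Continuous fun s : ℝ => (P₁ + P₂).eval (s ^ 2) := by fun_prop
      have hc₂ : Continuous fun s : ℝ => P₂.eval (s ^ 2) := by fun_prop
      have := radialInverse_sub (n := n) hc₁ hc₂ r
      simp only [Polynomial.eval_add, add_sub_cancel_right] at this ⊢
      rw [h₁, h₂, this]; ring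
    · have := h₁' s
      have := h₂' s
      simp only [Polynomial.derivative_add, Polynomial.eval_add]
      linarith
  | monomial j a =>
    have hn' : (0 : ℝ) < n := by exact_mod_cast hn
    refine ⟨Polynomial.monomial (j + 1) (a / ((2 * j + 2) * (2 * j + n))), fun r => ?_,
      fun s => ?_⟩
    · have e1 : ∀ s, radialAverage n (fun s => (Polynomial.monomial j a).eval (s ^ 2)) s =
          a * s ^ (2 * j) / (2 * j + n) := by
        intro s
        have e2 : ∀ θ : ℝ, θ ^ (n - 1) * (Polynomial.monomial j a).eval ((s * θ) ^ 2) =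
            (a * s ^ (2 * j)) * θ ^ (2 * j + (n - 1)) := by
          intro θ
          rw [Polynomial.eval_monomial, ← pow_mul, mul_pow, pow_add]; ring
        simp only [radialAverage, e2]
        rw [intervalIntegral.integral_const_mul, integral_pow, one_pow, zero_pow (by omega)]
        have : ((2 * j + (n - 1) : ℕ) : ℝ) + 1 = 2 * j + n := by
          rw [Nat.cast_add, Nat.cast_sub hn]; push_cast; ring
        rw [this]; ring
      simp only [radialInverse, e1]
      have e3 : ∀ s : ℝ, s * (a * s ^ (2 * j) / (2 * j + n)) =
          a / (2 * j + n) * s ^ (2 * j + 1) := by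
        intro s; rw [pow_succ]; ring
      simp only [e3]
      rw [intervalIntegral.integral_const_mul, integral_pow, Polynomial.eval_monomial,
        zero_pow (by omega), ← pow_mul]
      push_cast
      have : 2 * (j + 1) = 2 * j + 1 + 1 := by ring
      rw [this]
      field_simp
      ring
    · simp only [Polynomial.derivative_monomial, Polynomial.eval_monomial]
      rcases Nat.eq_zero_or_pos j with h | h
      · subst h; simp; field_simp
      · obtain ⟨i, rfl⟩ := Nat.exists_eq_succ_of_ne_zero h.ne'
        simp only [Nat.succ_eq_add_one, Nat.add_sub_cancel]
        push_cast
        field_simp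
        ring

/-- The Laplacian on Euclidean space, as the sum of the second partial derivatives. -/
noncomputable def euclideanLaplacian {n : ℕ} (ψ : EuclideanSpace ℝ (Fin n) → ℝ)
    (x : EuclideanSpace ℝ (Fin n)) : ℝ :=
  ∑ i, fderiv ℝ (fun y => fderiv ℝ ψ y (EuclideanSpace.single i 1)) x (EuclideanSpace.single i 1)

theorem euclideanLaplacian_polynomial_norm_sq {n : ℕ} (Q : Polynomial ℝ)
    (x : EuclideanSpace ℝ (Fin n)) :
    euclideanLaplacian (fun y => Q.eval (‖y‖ ^ 2)) x =
      4 * ‖x‖ ^ 2 * Q.derivative.derivative.eval (‖x‖ ^ 2) +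
        2 * n * Q.derivative.eval (‖x‖ ^ 2) := by
  have hd : ∀ (P : Polynomial ℝ) (y : EuclideanSpace ℝ (Fin n)),
      HasFDerivAt (fun y : EuclideanSpace ℝ (Fin n) => P.eval (‖y‖ ^ 2))
        (P.derivative.eval (‖y‖ ^ 2) • (2 • innerSL ℝ y)) y := by
    intro P y
    exact (P.hasDerivAt _).comp_hasFDerivAt y (hasStrictFDerivAt_norm_sq y).hasFDerivAt
  have hd1 : ∀ (i : Fin n) (y : EuclideanSpace ℝ (Fin n)),
      fderiv ℝ (fun y : EuclideanSpace ℝ (Fin n) => Q.eval (‖y‖ ^ 2)) y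
        (EuclideanSpace.single i 1) = Q.derivative.eval (‖y‖ ^ 2) * (2 * y i) := by
    intro i y
    rw [(hd Q y).fderiv]
    simp [EuclideanSpace.inner_single_right]
  have hd2 : ∀ i : Fin n, fderiv ℝ (fun y : EuclideanSpace ℝ (Fin n) =>
      Q.derivative.eval (‖y‖ ^ 2) * (2 * y i)) x (EuclideanSpace.single i 1) =
      4 * (x i) ^ 2 * Q.derivative.derivative.eval (‖x‖ ^ 2) +
        2 * Q.derivative.eval (‖x‖ ^ 2) := by
    intro i
    have e1 : HasFDerivAt (fun y : EuclideanSpace ℝ (Fin n) => y i)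
      (EuclideanSpace.proj i : EuclideanSpace ℝ (Fin n) →L[ℝ] ℝ) x :=
      (EuclideanSpace.proj i : EuclideanSpace ℝ (Fin n) →L[ℝ] ℝ).hasFDerivAt
    have e2 := ((hd Q.derivative x).fun_mul (e1.const_mul 2)).fderiv
    rw [e2]
    simp [EuclideanSpace.inner_single_right]
    ring
  simp only [euclideanLaplacian, hd1, hd2]
  rw [Finset.sum_add_distrib, ← Finset.sum_mul, ← Finset.mul_sum, EuclideanSpace.norm_sq_eq]
  simp
  ring

/-- Approximate the right-hand side `W h`, rather than `h`, by a polynomial in `r²` and invert the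
Laplacian exactly. The error in the Laplacian is then at most `δ`, and integrating it gives the
error in `h`. -/
theorem exists_smooth_approx_radial {n : ℕ} (hn : 0 < n) {W h : ℝ → ℝ} (hW : Continuous W)
    (hh : Continuous h) (heq : ∀ r, h r = 1 + radialInverse n (fun s => W s * h s) r)
    {R δ : ℝ} (hδ : 0 < δ) :
    ∃ q : EuclideanSpace ℝ (Fin n) → ℝ, ContDiff ℝ ∞ q ∧
      (∀ x, ‖x‖ ≤ R → |q x - h ‖x‖| ≤ δ * R ^ 2) ∧
      ∀ x, ‖x‖ ≤ R → |euclideanLaplacian q x - W ‖x‖ * h ‖x‖| ≤ δ := by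
  -- Weierstrass is applied in the variable `s = r²`, where continuity of `W (√s) h (√s)` suffices.
  obtain ⟨P, hP⟩ := exists_polynomial_near_of_continuousOn 0 (R ^ 2)
    (fun s => W (√s) * h (√s)) (by fun_prop) δ hδ
  have hP' : ∀ r ∈ Icc 0 R, |P.eval (r ^ 2) - W r * h r| ≤ δ := by
    intro r hr
    have := hP (r ^ 2) ⟨by positivity, pow_le_pow_left₀ hr.1 hr.2 2⟩
    rw [Real.sqrt_sq hr.1] at this
    exact this.le
  obtain ⟨Q, hQ, hQ'⟩ := radialInverse_polynomial hn P
  refine ⟨fun x => (1 + Q).eval (‖x‖ ^ 2), ?_, fun x hx => ?_, fun x hx => ?_⟩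
  · simp only [← Polynomial.coe_aeval_eq_eval]
    exact (Polynomial.contDiff_aeval (𝕜 := ℝ) (1 + Q) ∞).comp
        (contDiff_norm_sq ℝ (E := EuclideanSpace ℝ (Fin n)))
  · have hc₁ : Continuous fun s : ℝ => P.eval (s ^ 2) := by fun_prop
    have e := radialInverse_sub (n := n) hc₁ (G := fun s => W s * h s) (by fun_prop) ‖x‖
    have := abs_radialInverse_le (n := n) (r := ‖x‖) (R := R) ⟨norm_nonneg x, hx⟩ hP'
    rw [e] at this
    simp only [heq ‖x‖, Polynomial.eval_add, Polynomial.eval_one, hQ]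
    rwa [add_sub_add_left_eq_sub]
  · rw [euclideanLaplacian_polynomial_norm_sq]
    have := hQ' (‖x‖ ^ 2)
    simp only [Polynomial.derivative_add, Polynomial.derivative_one, zero_add]
    rw [this]
    exact hP' _ ⟨norm_nonneg x, hx⟩

/-! ### The weak formulation for products of a time and a space function -/

theorem integrable_mul_of_memLp_two {n : ℕ} {v w : EuclideanSpace ℝ (Fin n) → ℝ}
    (hv : MemLp v 2 volume) (hw : Continuous w) (hwc : HasCompactSupport w) :
    Integrable (fun x => v x * w x) :=
  MemLp.integrable_mul hv (hw.memLp_of_hasCompactSupport (p := 2) hwc)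

theorem exists_continuousLinearMap_integral_mul {n : ℕ} {w : EuclideanSpace ℝ (Fin n) → ℝ}
    (hw : Continuous w) (hwc : HasCompactSupport w) :
    ∃ L : Lp ℝ 2 (volume : Measure (EuclideanSpace ℝ (Fin n))) →L[ℝ] ℝ,
      ∀ v, L v = ∫ x, v x * w x := by
  have hwL : MemLp w 2 volume := hw.memLp_of_hasCompactSupport hwc
  refine ⟨innerSL ℝ (hwL.toLp w), fun v => ?_⟩
  rw [innerSL_apply_apply, L2.inner_def]
  apply integral_congr_ae
  filter_upwards [hwL.coeFn_toLp] with x hx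
  rw [hx]
  simp

theorem intervalIntegral_eq_of_eq_zero_of_le {F : ℝ → ℝ} {S T : ℝ} (hS : 0 ≤ S) (hST : S ≤ T)
    (hF : ∀ t, S < t → t ≤ T → F t = 0) : ∫ t in (0 : ℝ)..T, F t = ∫ t in (0 : ℝ)..S, F t := by
  rw [intervalIntegral.integral_of_le hS, intervalIntegral.integral_of_le (hS.trans hST)]
  refine setIntegral_eq_of_subset_of_forall_sdiff_eq_zero measurableSet_Ioc
    (Ioc_subset_Ioc_right hST) fun t ht => hF t ?_ ht.1.2
  by_contra h
  exact ht.2 ⟨ht.1.1, not_lt.1 h⟩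

theorem isTestFunction_mul {n : ℕ} {T : ℝ} (hT : 0 < T) {a : ℝ → ℝ} (ha : ContDiff ℝ ∞ a)
    (ha0 : ∀ t, T / 2 ≤ |t| → a t = 0) {ψ : EuclideanSpace ℝ (Fin n) → ℝ}
    (hψ : ContDiff ℝ ∞ ψ) (hψc : HasCompactSupport ψ) :
    IsTestFunction T (fun t x => a t * ψ x) := by
  have hsub : Function.support (Function.uncurry fun t x => a t * ψ x) ⊆
      Icc (-(T / 2)) (T / 2) ×ˢ tsupport ψ := by
    rintro ⟨t, x⟩ h
    simp only [Function.uncurry_apply_pair, Function.mem_support, ne_eq, mul_eq_zero, not_or] at h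
    refine ⟨abs_le.1 ?_, subset_tsupport ψ h.2⟩
    by_contra h'
    exact h.1 (ha0 t (not_le.1 h').le)
  refine ⟨?_, HasCompactSupport.of_support_subset_isCompact (isCompact_Icc.prod hψc) hsub, ?_⟩
  · exact (ha.comp contDiff_fst).mul (hψ.comp contDiff_snd)
  · intro z hz
    have : z ∈ Icc (-(T / 2)) (T / 2) ×ˢ tsupport ψ :=
      closure_minimal hsub (isClosed_Icc.prod (isClosed_tsupport ψ)) hz
    have := this.1.2
    linarith

theorem continuous_damping {n : ℕ} (μ β : ℝ) :
    Continuous (damping μ β : EuclideanSpace ℝ (Fin n) → ℝ) := by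
  have hpos : ∀ x : EuclideanSpace ℝ (Fin n), 0 < 1 + ‖x‖ := fun x => by positivity
  refine continuous_const.div ?_ fun x => (Real.rpow_pos_of_pos (hpos x) _).ne'
  exact Continuous.rpow_const (by fun_prop) fun x => Or.inl (hpos x).ne'

theorem integral_inner_gradient {n : ℕ}
    {U : Lp ℝ 2 (volume : Measure (EuclideanSpace ℝ (Fin n)))}
    {G : Lp (EuclideanSpace ℝ (Fin n)) 2 (volume : Measure (EuclideanSpace ℝ (Fin n)))}
    (hG : HasWeakGradient U G) {ψ : EuclideanSpace ℝ (Fin n) → ℝ}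
    (hψ : ContDiff ℝ ∞ ψ) (hψc : HasCompactSupport ψ) :
    ∫ x, inner ℝ (G x) (gradient ψ x) = - ∫ x, U x * euclideanLaplacian ψ x := by
  have hd : ∀ (φ : EuclideanSpace ℝ (Fin n) → ℝ) (e : EuclideanSpace ℝ (Fin n)),
      ContDiff ℝ ∞ φ → ContDiff ℝ ∞ fun y => fderiv ℝ φ y e := by
    intro φ e hφ
    exact (hφ.fderiv_right (m := ∞) (by simp)).clm_apply contDiff_const
  have hdc : ∀ (φ : EuclideanSpace ℝ (Fin n) → ℝ) (e : EuclideanSpace ℝ (Fin n)),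
      HasCompactSupport φ → HasCompactSupport fun y => fderiv ℝ φ y e :=
    fun φ e hφ => hφ.fderiv_apply ℝ e
  have e1 : ∀ x, inner ℝ (G x) (gradient ψ x) =
      ∑ i, inner ℝ (G x) (EuclideanSpace.single i (1 : ℝ)) *
        fderiv ℝ ψ x (EuclideanSpace.single i 1) := by
    intro x
    rw [real_inner_comm, gradient, InnerProductSpace.toDual_symm_apply]
    conv_lhs => rw [← (EuclideanSpace.basisFun (Fin n) ℝ).sum_repr (G x)]
    rw [map_sum]
    refine Finset.sum_congr rfl fun i _ => ?_
    simp [EuclideanSpace.inner_single_right]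
  have hGi : ∀ i : Fin n, MemLp (fun x => inner ℝ (G x) (EuclideanSpace.single i (1 : ℝ))) 2
      volume := fun i => (Lp.memLp G).inner_const _
  simp only [e1, euclideanLaplacian, Finset.mul_sum]
  rw [integral_finsetSum, integral_finsetSum, ← Finset.sum_neg_distrib]
  · refine Finset.sum_congr rfl fun i _ => ?_
    rw [hG _ (hd ψ (EuclideanSpace.single i 1) hψ) (hdc ψ _ hψc) (EuclideanSpace.single i 1),
      neg_neg]
  · intro i _
    exact integrable_mul_of_memLp_two (Lp.memLp U) (hd _ _ (hd _ _ hψ)).continuous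
      (hdc _ _ (hdc _ _ hψc))
  · intro i _
    exact integrable_mul_of_memLp_two (hGi i) (hd _ _ hψ).continuous (hdc _ _ hψc)

theorem continuous_euclideanLaplacian {n : ℕ} {ψ : EuclideanSpace ℝ (Fin n) → ℝ}
    (hψ : ContDiff ℝ ∞ ψ) : Continuous (euclideanLaplacian ψ) := by
  refine continuous_finsetSum _ fun i _ => ?_
  have h1 : ContDiff ℝ ∞ fun y => fderiv ℝ ψ y (EuclideanSpace.single i 1) :=
    (hψ.fderiv_right (m := ∞) (by simp)).clm_apply contDiff_const
  exact (h1.continuous_fderiv (by simp)).clm_apply continuous_const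

theorem hasCompactSupport_euclideanLaplacian {n : ℕ} {ψ : EuclideanSpace ℝ (Fin n) → ℝ}
    (hψc : HasCompactSupport ψ) : HasCompactSupport (euclideanLaplacian ψ) := by
  refine HasCompactSupport.of_support_subset_isCompact hψc fun x hx => ?_
  by_contra h
  apply hx
  refine Finset.sum_eq_zero fun i _ => ?_
  have h1 : x ∉ tsupport fun y => fderiv ℝ
      (fun y => fderiv ℝ ψ y (EuclideanSpace.single i 1)) y (EuclideanSpace.single i 1) :=
    fun h' => h (tsupport_fderiv_apply_subset ℝ _ (tsupport_fderiv_apply_subset ℝ _ h'))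
  exact Function.notMem_support.1 fun h' => h1 (subset_tsupport _ h')

section EnergySolution

variable {n : ℕ} {μ β p ε T : ℝ} {f g : EuclideanSpace ℝ (Fin n) → ℝ}
  {u : ℝ → EuclideanSpace ℝ (Fin n) → ℝ}
  {U V : ℝ → Lp ℝ 2 (volume : Measure (EuclideanSpace ℝ (Fin n)))}
  {G : ℝ → Lp (EuclideanSpace ℝ (Fin n)) 2 (volume : Measure (EuclideanSpace ℝ (Fin n)))}

theorem IsEnergySolutionWith.exists_moment (sol : IsEnergySolutionWith μ β p ε f g T u U V G)
    {w : EuclideanSpace ℝ (Fin n) → ℝ} (hw : Continuous w) (hwc : HasCompactSupport w) :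
    ∃ L : Lp ℝ 2 (volume : Measure (EuclideanSpace ℝ (Fin n))) →L[ℝ] ℝ,
      (∀ v, L v = ∫ x, v x * w x) ∧ ∀ t ∈ Ico 0 T, ∫ x, u t x * w x = L (U t) := by
  obtain ⟨L, hL⟩ := exists_continuousLinearMap_integral_mul hw hwc
  refine ⟨L, hL, fun t ht => ?_⟩
  rw [hL]
  apply integral_congr_ae
  filter_upwards [sol.curve t ht] with x hx
  rw [hx]

/-- For `Ψ = a(t) ψ(x)` all derivatives can be moved onto the test function: the weak gradient gives
the Laplacian, and integration by parts in time removes `u_t`, at the price of the boundary term `ε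
a'(0) ∫ f ψ`. Only moments of `u` itself remain. -/
theorem IsEnergySolutionWith.weak_separated (sol : IsEnergySolutionWith μ β p ε f g T u U V G)
    (hT : 0 < T) {a : ℝ → ℝ} (ha : ContDiff ℝ ∞ a) (ha0 : ∀ t, T / 2 ≤ |t| → a t = 0)
    {ψ : EuclideanSpace ℝ (Fin n) → ℝ} (hψ : ContDiff ℝ ∞ ψ) (hψc : HasCompactSupport ψ) :
    ε * a 0 * (∫ x, g x * ψ x) + ε * a 0 * (∫ x, damping μ β x * f x * ψ x)
        - ε * deriv a 0 * (∫ x, f x * ψ x)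
        + (∫ t in (0 : ℝ)..T, a t * ∫ x, |u t x| ^ p * ψ x)
      = ∫ t in (0 : ℝ)..(3 / 4 * T), (deriv (deriv a) t * (∫ x, u t x * ψ x)
          - a t * (∫ x, u t x * euclideanLaplacian ψ x)
          - deriv a t * (∫ x, u t x * (damping μ β x * ψ x))) := by
  have hweak := sol.weak _ (isTestFunction_mul hT ha ha0 hψ hψc)
  -- Any time strictly between `T/2` and `T` would do: `a` vanishes near `S`, and the solution is
  -- continuous on the compact interval `[0, S]`.
  set S := 3 / 4 * T with hS
  have hS0 : 0 < S := by positivity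
  have hST : S < T := by rw [hS]; linarith
  have ha1 : ContDiff ℝ ∞ (deriv a) := (contDiff_infty_iff_deriv.1 ha).2
  have ha2 : ContDiff ℝ ∞ (deriv (deriv a)) := (contDiff_infty_iff_deriv.1 ha1).2
  have hz : ∀ t, T / 2 < t → a =ᶠ[nhds t] fun _ => 0 := fun t ht => by
    filter_upwards [lt_mem_nhds ht] with s hs
    exact ha0 s (hs.le.trans (le_abs_self s))
  have hz1 : ∀ t, S ≤ t → deriv a t = 0 := fun t ht => by
    have := (hz t (by linarith)).deriv_eq
    simpa using this
  have hz0 : ∀ t, S ≤ t → a t = 0 := fun t ht => (hz t (by linarith)).eq_of_nhds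
  obtain ⟨L1, hL1, hm1⟩ := sol.exists_moment hψ.continuous hψc
  obtain ⟨L2, hL2, hm2⟩ := sol.exists_moment (continuous_euclideanLaplacian hψ)
    (hasCompactSupport_euclideanLaplacian hψc)
  obtain ⟨L3, hL3, hm3⟩ := sol.exists_moment ((continuous_damping μ β).mul hψ.continuous)
    (hψc.mul_left (f := damping μ β))
  simp only [Pi.mul_apply] at hm3
  have hsub : Icc 0 S ⊆ Ico 0 T := fun t ht => ⟨ht.1, ht.2.trans_lt hST⟩
  have hcU : ContinuousOn U (Icc 0 S) := sol.continuousOn.mono hsub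
  have hcV : ContinuousOn V (Icc 0 S) := sol.continuousOn_deriv.mono hsub
  have hcL : ∀ L : Lp ℝ 2 (volume : Measure (EuclideanSpace ℝ (Fin n))) →L[ℝ] ℝ,
      ContinuousOn (fun t => L (U t)) (Icc 0 S) := fun L => L.continuous.comp_continuousOn hcU
  have hint : ∀ (b : ℝ → ℝ) (m : ℝ → ℝ), Continuous b → ContinuousOn m (Icc 0 S) →
      IntervalIntegrable (fun t => b t * m t) volume 0 S := fun b m hb hm => by
    apply ContinuousOn.intervalIntegrable
    rw [uIcc_of_le hS0.le]
    exact hb.continuousOn.mul hm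
  have e0 : (∫ x, g x * (a 0 * ψ x)) = a 0 * ∫ x, g x * ψ x := by
    rw [← integral_const_mul]; congr 1; ext x; ring
  have e0' : (∫ x, damping μ β x * f x * (a 0 * ψ x)) = a 0 * ∫ x, damping μ β x * f x * ψ x := by
    rw [← integral_const_mul]; congr 1; ext x; ring
  have eN : ∀ t, (∫ x, |u t x| ^ p * (a t * ψ x)) = a t * ∫ x, |u t x| ^ p * ψ x := fun t => by
    rw [← integral_const_mul]; congr 1; ext x; ring
  have hda : ∀ t x, deriv (fun s => a s * ψ x) t = deriv a t * ψ x := fun t x =>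
    deriv_mul_const (ha.differentiable (by simp) t) _
  have eV : (∫ t in (0 : ℝ)..T, ∫ x, V t x * deriv (fun s => a s * ψ x) t) =
      ∫ t in (0 : ℝ)..S, deriv a t * L1 (V t) := by
    have : ∀ t, (∫ x, V t x * deriv (fun s => a s * ψ x) t) = deriv a t * L1 (V t) := fun t => by
      rw [hL1, ← integral_const_mul]; congr 1; ext x; rw [hda]; ring
    simp only [this]
    exact intervalIntegral_eq_of_eq_zero_of_le hS0.le hST.le fun t ht _ => by
      rw [hz1 t ht.le, zero_mul]
  have eG : (∫ t in (0 : ℝ)..T, ∫ x, inner ℝ (G t x) (gradient (fun x => a t * ψ x) x)) =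
      ∫ t in (0 : ℝ)..S, -(a t * L2 (U t)) := by
    have : ∀ t, (∫ x, inner ℝ (G t x) (gradient (fun x => a t * ψ x) x)) =
        a t * ∫ x, inner ℝ (G t x) (gradient ψ x) := fun t => by
      rw [← integral_const_mul]; congr 1; ext x
      simp only [gradient]
      rw [real_inner_comm, InnerProductSpace.toDual_symm_apply, real_inner_comm,
        InnerProductSpace.toDual_symm_apply, fderiv_const_mul (hψ.differentiable (by simp) x)]
      simp
    simp only [this]
    rw [intervalIntegral_eq_of_eq_zero_of_le hS0.le hST.le fun t ht _ => by
      rw [hz0 t ht.le, zero_mul]]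
    refine intervalIntegral.integral_congr fun t ht => ?_
    rw [uIcc_of_le hS0.le] at ht
    show a t * _ = _
    rw [integral_inner_gradient (sol.weakGradient t (hsub ht)) hψ hψc, ← hL2]
    ring
  have eD : (∫ t in (0 : ℝ)..T, ∫ x, damping μ β x * u t x * deriv (fun s => a s * ψ x) t) =
      ∫ t in (0 : ℝ)..S, deriv a t * L3 (U t) := by
    have : ∀ t, (∫ x, damping μ β x * u t x * deriv (fun s => a s * ψ x) t) =
        deriv a t * ∫ x, u t x * (damping μ β x * ψ x) := fun t => by
      rw [← integral_const_mul]; congr 1; ext x; rw [hda]; ring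
    simp only [this]
    rw [intervalIntegral_eq_of_eq_zero_of_le hS0.le hST.le fun t ht _ => by
      rw [hz1 t ht.le, zero_mul]]
    refine intervalIntegral.integral_congr fun t ht => ?_
    rw [uIcc_of_le hS0.le] at ht
    show deriv a t * _ = _
    rw [hm3 t (hsub ht)]
  have hparts : ∫ t in (0 : ℝ)..S, deriv a t * L1 (V t) =
      - (ε * deriv a 0 * ∫ x, f x * ψ x) - ∫ t in (0 : ℝ)..S, deriv (deriv a) t * L1 (U t) := by
    rw [intervalIntegral.integral_mul_deriv_eq_deriv_mul_of_hasDerivAt (v := fun t => L1 (U t))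
      (u' := deriv (deriv a))]
    · rw [hz1 S le_rfl]
      have : L1 (U 0) = ε * ∫ x, f x * ψ x := by
        rw [hL1, ← integral_const_mul]
        apply integral_congr_ae
        filter_upwards [sol.initial] with x hx
        rw [hx]; ring
      rw [this]; ring
    · exact ha1.continuous.continuousOn
    · rw [uIcc_of_le hS0.le]; exact hcL L1
    · exact fun t _ => (ha1.differentiable (by simp) t).hasDerivAt
    · intro t ht
      rw [min_eq_left hS0.le, max_eq_right hS0.le] at ht
      have hd := (sol.hasDeriv t ⟨ht.1.le, ht.2.trans hST⟩).hasDerivAt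
        (Ico_mem_nhds ht.1 (ht.2.trans hST))
      exact L1.hasFDerivAt.comp_hasDerivAt t hd
    · exact ha2.continuous.intervalIntegrable _ _
    · apply ContinuousOn.intervalIntegrable
      rw [uIcc_of_le hS0.le]
      exact L1.continuous.comp_continuousOn hcV
  have hR : (∫ t in (0 : ℝ)..S, (deriv (deriv a) t * (∫ x, u t x * ψ x)
          - a t * (∫ x, u t x * euclideanLaplacian ψ x)
          - deriv a t * (∫ x, u t x * (damping μ β x * ψ x)))) =
      (∫ t in (0 : ℝ)..S, deriv (deriv a) t * L1 (U t)) + (∫ t in (0 : ℝ)..S, -(a t * L2 (U t)))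
        - ∫ t in (0 : ℝ)..S, deriv a t * L3 (U t) := by
    rw [intervalIntegral.integral_neg, ← sub_eq_add_neg,
      ← intervalIntegral.integral_sub (hint _ _ ha2.continuous (hcL L1))
        (hint _ _ ha.continuous (hcL L2)),
      ← intervalIntegral.integral_sub ((hint _ _ ha2.continuous (hcL L1)).sub
        (hint _ _ ha.continuous (hcL L2))) (hint _ _ ha1.continuous (hcL L3))]
    refine intervalIntegral.integral_congr fun t ht => ?_
    rw [uIcc_of_le hS0.le] at ht
    simp only [hm1 t (hsub ht), hm2 t (hsub ht), hm3 t (hsub ht)]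
  simp only [e0, e0', eN, eV, eG, eD, hparts] at hweak
  rw [hR]
  linarith

/-- Fubini applied to the integrability of `|u|^p a χ`. On the cone `χ = 1`, so `χ` drops out. For
almost every time with `a t ≠ 0` the slice `|u(t)|^p` is integrable, as Hölder requires. -/
theorem IsEnergySolutionWith.integrable_nonlinearity
    (sol : IsEnergySolutionWith μ β p ε f g T u U V G) (hT : 0 < T) (hp : 0 < p)
    (hsupp : SupportedInCone T u)
    {a : ℝ → ℝ} (ha : ContDiff ℝ ∞ a) (ha0 : ∀ t, T / 2 ≤ |t| → a t = 0)
    {χ : EuclideanSpace ℝ (Fin n) → ℝ} (hχ : ContDiff ℝ ∞ χ) (hχc : HasCompactSupport χ)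
    (hχ1 : ∀ x, ‖x‖ ≤ T + 1 → χ x = 1) :
    IntegrableOn (fun t => a t * ∫ x, |u t x| ^ p) (Ioo 0 T) ∧
      (∀ᵐ t ∂(volume.restrict (Ioo 0 T)), a t ≠ 0 → Integrable fun x => |u t x| ^ p) ∧
      ∀ t ∈ Ico 0 T, ∫ x, |u t x| ^ p * χ x = ∫ x, |u t x| ^ p := by
  have hχu : ∀ t ∈ Ico 0 T, (fun x => |u t x| ^ p * χ x) =ᵐ[volume] fun x => |u t x| ^ p := by
    intro t ht
    filter_upwards [hsupp t ht] with x hx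
    by_cases h : ‖x‖ ≤ T + 1
    · rw [hχ1 x h, mul_one]
    · rw [hx (by linarith [ht.2]), abs_zero, Real.zero_rpow hp.ne', zero_mul]
  have hint := sol.integrable _ (isTestFunction_mul hT ha ha0 hχ hχc)
  rw [IntegrableOn, Measure.volume_eq_prod, ← Measure.prod_restrict, Measure.restrict_univ] at hint
  have hX : ∀ t ∈ Ico 0 T, (∫ x, |u t x| ^ p * (a t * χ x)) = a t * ∫ x, |u t x| ^ p := by
    intro t ht
    rw [← integral_congr_ae (hχu t ht), ← integral_const_mul]; congr 1; ext x; ring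
  refine ⟨?_, ?_, fun t ht => integral_congr_ae (hχu t ht)⟩
  · refine (hint.integral_prod_left).congr ?_
    filter_upwards [ae_restrict_mem measurableSet_Ioo] with t ht
    exact hX t ⟨ht.1.le, ht.2⟩
  · filter_upwards [ae_restrict_mem measurableSet_Ioo, hint.prod_right_ae] with t ht hi hat
    have h1 := (hi.const_mul (a t)⁻¹).congr (g := fun x => |u t x| ^ p * χ x)
      (Filter.Eventually.of_forall fun x => by
        show (a t)⁻¹ * (|u t x| ^ p * (a t * χ x)) = _
        field_simp)
    exact h1.congr (hχu t ⟨ht.1.le, ht.2⟩)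

end EnergySolution

/-! ### The first test: a pure time cutoff -/

/-- `a` is a time cutoff at scale `T` whose first two derivatives are controlled by `a ^ (1 / p)`. -/
structure IsTimeCutoff (p C T : ℝ) (a : ℝ → ℝ) : Prop where
  smooth : ContDiff ℝ ∞ a
  nonneg : ∀ t, 0 ≤ a t
  le_one : ∀ t, a t ≤ 1
  zero : a 0 = 1
  deriv_zero : deriv a 0 = 0
  eq_zero : ∀ t, T / 2 ≤ |t| → a t = 0
  deriv_eq_zero : ∀ t, 0 ≤ t → t < T / 4 → deriv a t = 0 ∧ deriv (deriv a) t = 0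
  abs_deriv_le : ∀ t, |deriv a t| ≤ C * T⁻¹ * a t ^ (1 / p)
  abs_deriv_deriv_le : ∀ t, |deriv (deriv a) t| ≤ C * T⁻¹ ^ 2 * a t ^ (1 / p)

theorem exists_isTimeCutoff {p : ℝ} (hp : 1 < p) :
    ∃ C : ℝ, 0 < C ∧ ∀ T : ℝ, 0 < T → ∃ a, IsTimeCutoff p C T a := by
  obtain ⟨C, hC, h⟩ := exists_time_cutoff hp
  refine ⟨C, hC, fun T hT => ?_⟩
  obtain ⟨a, h1, h2, h3, h4, h5, h6, h7, h8, h9⟩ := h T hT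
  exact ⟨a, h1, h2, h3, h4, h5, h6, h7, h8, h9⟩

/-- Hölder in time against the constant `N`, which contributes `T^(1/q)`. In the applications `Y t =
a(t) ∫ |u|^p`; the factor `a^(1/p)` in the cutoff bounds is what makes this form available. -/
theorem abs_intervalIntegral_le_of_rpow_bound {p q : ℝ} (hpq : p.HolderConjugate q) {S T N : ℝ}
    (hS : 0 ≤ S) (hST : S < T) (hN : 0 ≤ N) {Y F : ℝ → ℝ} (hY0 : ∀ t, 0 ≤ Y t)
    (hY : IntegrableOn Y (Ioo 0 T))
    (hF : ∀ᵐ t ∂(volume.restrict (Ioo 0 T)), |F t| ≤ Y t ^ (1 / p) * N) :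
    |∫ t in (0 : ℝ)..S, F t| ≤ (∫ t in Ioo 0 T, Y t) ^ (1 / p) * (N * T ^ (1 / q)) := by
  have hp0 : 0 < p := hpq.pos
  have hq0 : 0 < q := hpq.symm.pos
  have hT : 0 < T := hS.trans_lt hST
  have hYL : MemLp (fun t => Y t ^ (1 / p)) (ENNReal.ofReal p) (volume.restrict (Ioo 0 T)) := by
    have hm : AEStronglyMeasurable (fun t => Y t ^ (1 / p)) (volume.restrict (Ioo 0 T)) :=
      (hY.aestronglyMeasurable.aemeasurable.pow_const _).aestronglyMeasurable
    rw [← integrable_norm_rpow_iff hm (by simpa using hp0) ENNReal.ofReal_ne_top,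
      ENNReal.toReal_ofReal hp0.le]
    refine hY.congr (Filter.Eventually.of_forall fun t => ?_)
    show Y t = ‖Y t ^ (1 / p)‖ ^ p
    rw [Real.norm_of_nonneg (Real.rpow_nonneg (hY0 t) _), ← Real.rpow_mul (hY0 t),
      one_div_mul_cancel hp0.ne', Real.rpow_one]
  have hNL : MemLp (fun _ : ℝ => N) (ENNReal.ofReal q) (volume.restrict (Ioo 0 T)) :=
    memLp_const N
  have hint : Integrable (fun t => Y t ^ (1 / p) * N) (volume.restrict (Ioo 0 T)) :=
    have := hpq.ennrealOfReal
    MemLp.integrable_mul (p := ENNReal.ofReal p) (q := ENNReal.ofReal q) hYL hNL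
  have hH := integral_mul_le_Lp_mul_Lq_of_nonneg hpq (μ := volume.restrict (Ioo 0 T))
    (Filter.Eventually.of_forall fun t => Real.rpow_nonneg (hY0 t) (1 / p))
    (Filter.Eventually.of_forall fun _ => hN) hYL hNL
  have e1 : (∫ t in Ioo 0 T, (Y t ^ (1 / p)) ^ p) = ∫ t in Ioo 0 T, Y t := by
    congr 1; ext t
    rw [← Real.rpow_mul (hY0 t), one_div_mul_cancel hp0.ne', Real.rpow_one]
  have e2 : (∫ _ in Ioo 0 T, N ^ q) ^ (1 / q) = N * T ^ (1 / q) := by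
    rw [setIntegral_const]
    simp only [measureReal_def, Real.volume_Ioo, sub_zero, ENNReal.toReal_ofReal hT.le,
      smul_eq_mul]
    rw [Real.mul_rpow hT.le (by positivity), ← Real.rpow_mul hN, mul_one_div_cancel hq0.ne',
      Real.rpow_one, mul_comm]
  rw [e1, e2] at hH
  refine le_trans ?_ hH
  rw [intervalIntegral.integral_of_le hS, ← Real.norm_eq_abs]
  have hsub : Ioc 0 S ⊆ Ioo 0 T := fun t ht => ⟨ht.1, ht.2.trans_lt hST⟩
  calc _ ≤ ∫ t in Ioc 0 S, Y t ^ (1 / p) * N := by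
        refine norm_integral_le_of_norm_le (hint.mono_measure (Measure.restrict_mono hsub le_rfl)) ?_
        exact ae_restrict_of_ae_restrict_of_subset hsub hF
    _ ≤ _ := setIntegral_mono_set hint
        (Filter.Eventually.of_forall fun t => mul_nonneg (Real.rpow_nonneg (hY0 t) _) hN)
        hsub.eventuallyLE

theorem euclideanLaplacian_congr {n : ℕ} {ψ φ : EuclideanSpace ℝ (Fin n) → ℝ}
    {x : EuclideanSpace ℝ (Fin n)} (h : ψ =ᶠ[nhds x] φ) :
    euclideanLaplacian ψ x = euclideanLaplacian φ x := by
  refine Finset.sum_congr rfl fun i _ => ?_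
  have h1 : (fun y => fderiv ℝ ψ y (EuclideanSpace.single i 1)) =ᶠ[nhds x]
      fun y => fderiv ℝ φ y (EuclideanSpace.single i 1) := by
    filter_upwards [h.fderiv (𝕜 := ℝ)] with y hy
    rw [hy]
  rw [h1.fderiv_eq]

theorem exists_space_cutoff (n : ℕ) {R : ℝ} (hR : 0 < R) :
    ∃ χ : EuclideanSpace ℝ (Fin n) → ℝ, ContDiff ℝ ∞ χ ∧ HasCompactSupport χ ∧ (∀ x, 0 ≤ χ x) ∧
      ∀ x, ‖x‖ ≤ R → χ =ᶠ[nhds x] fun _ => 1 := by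
  let b : ContDiffBump (0 : EuclideanSpace ℝ (Fin n)) :=
    ⟨R + 1, R + 2, by linarith, by linarith⟩
  refine ⟨b, b.contDiff, b.hasCompactSupport, fun x => b.nonneg, fun x hx => ?_⟩
  refine b.eventuallyEq_one_of_mem_ball ?_
  rw [mem_ball_zero_iff]
  exact hx.trans_lt (lt_add_one R)

theorem damping_nonneg {n : ℕ} {μ : ℝ} (hμ : 0 ≤ μ) (β : ℝ) (x : EuclideanSpace ℝ (Fin n)) :
    0 ≤ damping μ β x := by
  unfold damping; positivity

theorem damping_le {n : ℕ} {μ β : ℝ} (hμ : 0 ≤ μ) (hβ : 0 ≤ β) (x : EuclideanSpace ℝ (Fin n)) :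
    damping μ β x ≤ μ := by
  unfold damping
  refine div_le_self hμ (Real.one_le_rpow ?_ hβ)
  linarith [norm_nonneg x]

section EnergySolution

variable {n : ℕ} {μ β p q ε T C : ℝ} {f g : EuclideanSpace ℝ (Fin n) → ℝ}
  {u : ℝ → EuclideanSpace ℝ (Fin n) → ℝ} {a : ℝ → ℝ}
  {U V : ℝ → Lp ℝ 2 (volume : Measure (EuclideanSpace ℝ (Fin n)))}
  {G : ℝ → Lp (EuclideanSpace ℝ (Fin n)) 2 (volume : Measure (EuclideanSpace ℝ (Fin n)))}

theorem IsEnergySolutionWith.abs_moment_le (sol : IsEnergySolutionWith μ β p ε f g T u U V G)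
    (hsupp : SupportedInCone T u) (hpq : p.HolderConjugate q) {t : ℝ} (ht : t ∈ Ico 0 T)
    (hint : Integrable fun x => |u t x| ^ p) {R : ℝ} (hR : t + 1 ≤ R)
    {w W : EuclideanSpace ℝ (Fin n) → ℝ} (hW : Continuous W) (hwW : ∀ x, ‖x‖ ≤ R → |w x| ≤ W x) :
    |∫ x, u t x * w x| ≤ (∫ x, |u t x| ^ p) ^ (1 / p) *
      (∫ x in Metric.closedBall 0 R, W x ^ q) ^ (1 / q) := by
  refine abs_integral_mul_le_of_support_closedBall hpq
    ((Lp.aestronglyMeasurable (U t)).congr (sol.curve t ht).symm) hint ?_ hW hwW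
  filter_upwards [hsupp t ht] with x hx h
  exact hx (by linarith)

theorem moment_congr (hsupp : SupportedInCone T u) {t : ℝ} (ht : t ∈ Ico 0 T)
    {w w' : EuclideanSpace ℝ (Fin n) → ℝ} (hw : ∀ x, ‖x‖ ≤ T + 1 → w x = w' x) :
    ∫ x, u t x * w x = ∫ x, u t x * w' x := by
  apply integral_congr_ae
  filter_upwards [hsupp t ht] with x hx
  by_cases h : ‖x‖ ≤ T + 1
  · rw [hw x h]
  · rw [hx (by linarith [ht.2]), zero_mul, zero_mul]

theorem integral_mul_eq_of_support_unitBall {v w w' : EuclideanSpace ℝ (Fin n) → ℝ}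
    (hv : ∀ᵐ x, 1 < ‖x‖ → v x = 0) (hw : ∀ x, ‖x‖ ≤ 1 → w x = w' x) :
    ∫ x, v x * w x = ∫ x, v x * w' x := by
  apply integral_congr_ae
  filter_upwards [hv] with x hx
  by_cases h : ‖x‖ ≤ 1
  · rw [hw x h]
  · rw [hx (not_le.1 h), zero_mul, zero_mul]

theorem integral_mul_nonneg_of_support_unitBall {v w : EuclideanSpace ℝ (Fin n) → ℝ}
    (hv : ∀ᵐ x, 1 < ‖x‖ → v x = 0) (hv0 : ∀ᵐ x, 0 ≤ v x) (hw : ∀ x, ‖x‖ ≤ 1 → 0 ≤ w x) :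
    0 ≤ ∫ x, v x * w x := by
  apply integral_nonneg_of_ae
  filter_upwards [hv, hv0] with x hx hx0
  by_cases h : ‖x‖ ≤ 1
  · exact mul_nonneg hx0 (hw x h)
  · simp [hx (not_le.1 h)]

/-- Since `χ = 1` near the cone, the Laplacian term vanishes. Moreover `a'(0) = 0` removes the
boundary term, and the damped `f` term is nonnegative and dropped. The two remaining terms carry
`a''` and `a'`. -/
theorem IsEnergySolutionWith.time_cutoff_test
    (sol : IsEnergySolutionWith μ β p ε f g T u U V G) (hsupp : SupportedInCone T u)
    (hpq : p.HolderConjugate q) (hT : 0 < T) (hC : 0 ≤ C) (cut : IsTimeCutoff p C T a)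
    (hμ : 0 ≤ μ) (hε : 0 ≤ ε) (hf0 : ∀ᵐ x, 0 ≤ f x) (hfs : ∀ᵐ x, 1 < ‖x‖ → f x = 0)
    (hgs : ∀ᵐ x, 1 < ‖x‖ → g x = 0) :
    ε * (∫ x, g x) + (∫ t in Ioo 0 T, a t * ∫ x, |u t x| ^ p) ≤
      (∫ t in Ioo 0 T, a t * ∫ x, |u t x| ^ p) ^ (1 / p) *
        (C * (T⁻¹ ^ 2 *
            volume.real (Metric.closedBall (0 : EuclideanSpace ℝ (Fin n)) (T + 1)) ^ (1 / q) +
          T⁻¹ * (∫ x in Metric.closedBall (0 : EuclideanSpace ℝ (Fin n)) (T + 1),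
            damping μ β x ^ q) ^ (1 / q)) * T ^ (1 / q)) := by
  obtain ⟨χ, hχ, hχc, hχ0, hχ1⟩ := exists_space_cutoff n (R := T + 1) (by linarith)
  have hχ1' : ∀ x, ‖x‖ ≤ T + 1 → χ x = 1 := fun x hx => (hχ1 x hx).eq_of_nhds
  have hχ2 : ∀ x, ‖x‖ ≤ T + 1 → euclideanLaplacian χ x = 0 := fun x hx => by
    rw [euclideanLaplacian_congr (hχ1 x hx)]
    simp [euclideanLaplacian]
  obtain ⟨hY, hI, hXχ⟩ := sol.integrable_nonlinearity hT hpq.pos hsupp cut.smooth cut.eq_zero hχ hχc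
    hχ1'
  have hid := sol.weak_separated hT cut.smooth cut.eq_zero hχ hχc
  set X : ℝ → ℝ := fun t => ∫ x, |u t x| ^ p with hX
  have hX0 : ∀ t, 0 ≤ X t := fun t => integral_nonneg fun x => by positivity
  have e1 : (∫ t in (0 : ℝ)..T, a t * ∫ x, |u t x| ^ p * χ x) = ∫ t in Ioo 0 T, a t * X t := by
    rw [intervalIntegral.integral_of_le hT.le, integral_Ioc_eq_integral_Ioo]
    exact setIntegral_congr_fun measurableSet_Ioo fun t ht => by
      simp only [hXχ t ⟨ht.1.le, ht.2⟩, hX]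
  have e2 : ∫ x, g x * χ x = ∫ x, g x := by
    have := integral_mul_eq_of_support_unitBall (w := χ) (w' := fun _ => 1) hgs
      (fun x hx => hχ1' x (by linarith))
    simpa using this
  have e3 : 0 ≤ ∫ x, damping μ β x * f x * χ x := by
    have := integral_mul_nonneg_of_support_unitBall (w := fun x => damping μ β x * χ x) hfs hf0
      (fun x _ => mul_nonneg (damping_nonneg hμ β x) (hχ0 x))
    refine this.trans (le_of_eq ?_)
    congr 1; ext x; ring
  rw [cut.zero, cut.deriv_zero, e1, e2] at hid
  set V₁ := volume.real (Metric.closedBall (0 : EuclideanSpace ℝ (Fin n)) (T + 1)) ^ (1 / q)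
  set V₂ := (∫ x in Metric.closedBall (0 : EuclideanSpace ℝ (Fin n)) (T + 1),
            damping μ β x ^ q) ^ (1 / q)
  have hV₁ : 0 ≤ V₁ := by positivity
  have hV₂ : 0 ≤ V₂ := Real.rpow_nonneg (integral_nonneg fun x =>
    Real.rpow_nonneg (damping_nonneg hμ β x) _) _
  have hN : 0 ≤ C * (T⁻¹ ^ 2 * V₁ + T⁻¹ * V₂) := by positivity
  have hbound := abs_intervalIntegral_le_of_rpow_bound hpq (S := 3 / 4 * T) (T := T)
    (N := C * (T⁻¹ ^ 2 * V₁ + T⁻¹ * V₂)) (Y := fun t => a t * X t)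
    (F := fun t => deriv (deriv a) t * (∫ x, u t x * χ x)
          - a t * (∫ x, u t x * euclideanLaplacian χ x)
          - deriv a t * (∫ x, u t x * (damping μ β x * χ x)))
    (by positivity) (by linarith) hN (fun t => mul_nonneg (cut.nonneg t) (hX0 t)) hY ?_
  · have h1 := (le_abs_self _).trans hbound
    rw [← hid] at h1
    have h2 := mul_nonneg hε e3
    linarith
  filter_upwards [hI, ae_restrict_mem measurableSet_Ioo] with t hIt ht
  have ht' : t ∈ Ico 0 T := ⟨ht.1.le, ht.2⟩
  have hd1 := cut.abs_deriv_le t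
  have hd2 := cut.abs_deriv_deriv_le t
  have z1 : ∫ x, u t x * euclideanLaplacian χ x = 0 := by
    rw [moment_congr hsupp ht' (w' := fun _ => 0) hχ2]; simp
  rw [z1, mul_zero, sub_zero]
  have hp0 := hpq.pos
  -- Where `a t = 0` the slice need not be integrable, but the cutoff bounds force `a'` and `a''` to
  -- vanish too.
  by_cases hat : a t = 0
  · rw [hat, Real.zero_rpow (by positivity), mul_zero] at hd1 hd2
    rw [abs_eq_zero.1 (le_antisymm hd1 (abs_nonneg _)),
      abs_eq_zero.1 (le_antisymm hd2 (abs_nonneg _)), hat]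
    simp only [zero_mul, sub_zero, abs_zero]
    positivity
  · have m1 : |∫ x, u t x * χ x| ≤ X t ^ (1 / p) * V₁ := by
      have := sol.abs_moment_le hsupp hpq ht' (hIt hat) (R := T + 1) (by linarith [ht.2]) (w := χ)
        (W := fun _ => 1) continuous_const (fun x hx => by rw [hχ1' x hx, abs_one])
      simpa [V₁, X] using this
    have m2 : |∫ x, u t x * (damping μ β x * χ x)| ≤ X t ^ (1 / p) * V₂ :=
      sol.abs_moment_le hsupp hpq ht' (hIt hat) (R := T + 1) (by linarith [ht.2])
        (W := damping μ β) (continuous_damping μ β) (fun x hx => by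
          rw [hχ1' x hx, mul_one, abs_of_nonneg (damping_nonneg hμ β x)])
    rw [Real.mul_rpow (cut.nonneg t) (hX0 t)]
    have hX' := Real.rpow_nonneg (hX0 t) (1 / p)
    have ha' := Real.rpow_nonneg (cut.nonneg t) (1 / p)
    calc _ ≤ |deriv (deriv a) t * ∫ x, u t x * χ x| +
          |deriv a t * ∫ x, u t x * (damping μ β x * χ x)| := abs_sub _ _
      _ ≤ (C * T⁻¹ ^ 2 * a t ^ (1 / p)) * (X t ^ (1 / p) * V₁) +
          (C * T⁻¹ * a t ^ (1 / p)) * (X t ^ (1 / p) * V₂) := by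
        rw [abs_mul, abs_mul]; gcongr
      _ = _ := by ring

end EnergySolution

/-! ### The approximate eigenfunction and the exponential test -/

/-- Smooth positive approximate solutions of `Δφ = (1 + damping) φ` with sharp exponential growth. -/
theorem exists_smooth_approx_eigenfunction {n : ℕ} (hn : 0 < n) {μ β : ℝ} (hμ : 0 ≤ μ)
    (hβ : 2 ≤ β) :
    ∃ K : ℝ, 0 < K ∧ ∀ R δ : ℝ, 0 < δ → δ ≤ 1 →
      ∃ φ : EuclideanSpace ℝ (Fin n) → ℝ, ContDiff ℝ ∞ φ ∧ ∀ x, ‖x‖ ≤ R → 1 / 2 ≤ φ x ∧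
        φ x ≤ K * ((1 + ‖x‖) ^ (-(((n : ℝ) - 1) / 2)) * Real.exp ‖x‖) ∧
        |φ x + damping μ β x * φ x - euclideanLaplacian φ x| ≤ δ := by
  set W : ℝ → ℝ := fun r => 1 + μ / (1 + |r|) ^ β with hWdef
  have hpos : ∀ r : ℝ, 0 < 1 + |r| := fun r => by positivity
  have hW : Continuous W := by
    refine continuous_const.add (continuous_const.div ?_
      fun r => (Real.rpow_pos_of_pos (hpos r) _).ne')
    exact Continuous.rpow_const (by fun_prop) fun r => Or.inl (hpos r).ne'
  have hW0 : ∀ r, 0 ≤ W r := fun r => by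
    have := hpos r
    simp only [hWdef]; positivity
  have hWM : ∀ r, W r ≤ 1 + μ := fun r => by
    simp only [hWdef]
    gcongr
    exact div_le_self hμ (Real.one_le_rpow (by linarith [abs_nonneg r]) (by linarith))
  have hWμ : ∀ r, 1 ≤ r → W r ≤ 1 + μ / r ^ 2 := fun r hr => by
    simp only [hWdef]
    have h0 : 0 < r := by linarith
    gcongr
    rw [abs_of_pos h0]
    calc r ^ 2 ≤ (1 + r) ^ 2 := by gcongr; linarith
      _ = (1 + r) ^ (2 : ℝ) := by norm_cast
      _ ≤ _ := Real.rpow_le_rpow_of_exponent_le (by linarith) hβ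
  have hWD : ∀ x : EuclideanSpace ℝ (Fin n), W ‖x‖ = 1 + damping μ β x := fun x => by
    simp [hWdef, damping]
  obtain ⟨h, hc, h1, heq⟩ := exists_radial_fixedPoint n hW (M := 1 + μ) (by linarith) hW0 hWM
  obtain ⟨K, hK, hgrow⟩ := radial_fixedPoint_growth hn hW hc hW0 hμ hWμ h1 heq
  refine ⟨2 * K, by positivity, fun R δ hδ hδ1 => ?_⟩
  -- This makes `(1 + μ) δ' R² + δ' ≤ δ`, the error in the equation, and `δ' R² ≤ 1/2`. As `h ≥ 1`,
  -- the latter gives `1/2 ≤ φ ≤ 2h`, so the growth constant depends on neither `R` nor `δ`.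
  set δ' := δ / (2 * (1 + μ) * (1 + R ^ 2)) with hδ'
  have hδ'0 : 0 < δ' := by positivity
  have hδ'e : (1 + μ) * (δ' * (1 + R ^ 2)) = δ / 2 := by
    rw [hδ']; field_simp
  have hδ'R : δ' * R ^ 2 ≤ 1 / 2 := by
    have h2 : δ' * (1 + R ^ 2) ≤ (1 + μ) * (δ' * (1 + R ^ 2)) := by
      have : 0 ≤ δ' * (1 + R ^ 2) := by positivity
      nlinarith
    nlinarith
  obtain ⟨φ, hφ, hφ1, hφ2⟩ := exists_smooth_approx_radial hn hW hc heq (R := R) hδ'0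
  refine ⟨φ, hφ, fun x hx => ?_⟩
  have a1 := abs_le.1 (hφ1 x hx)
  have a2 := hφ2 x hx
  have a3 := h1 ‖x‖
  have a4 := hgrow ‖x‖ (norm_nonneg x)
  refine ⟨by linarith, ?_, ?_⟩
  · linarith
  · have e : φ x + damping μ β x * φ x - euclideanLaplacian φ x =
        W ‖x‖ * (φ x - h ‖x‖) - (euclideanLaplacian φ x - W ‖x‖ * h ‖x‖) := by
      rw [hWD]; ring
    rw [e]
    calc _ ≤ |W ‖x‖ * (φ x - h ‖x‖)| + |euclideanLaplacian φ x - W ‖x‖ * h ‖x‖| := abs_sub _ _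
      _ ≤ (1 + μ) * (δ' * R ^ 2) + δ' := by
        rw [abs_mul, abs_of_nonneg (hW0 _)]
        gcongr
        · exact hWM _
        · exact hφ1 x hx
      _ ≤ δ := by nlinarith

section EnergySolution

variable {n : ℕ} {μ β p q ε T C : ℝ} {f g : EuclideanSpace ℝ (Fin n) → ℝ}
  {u : ℝ → EuclideanSpace ℝ (Fin n) → ℝ} {a : ℝ → ℝ}
  {U V : ℝ → Lp ℝ 2 (volume : Measure (EuclideanSpace ℝ (Fin n)))}
  {G : ℝ → Lp (EuclideanSpace ℝ (Fin n)) 2 (volume : Measure (EuclideanSpace ℝ (Fin n)))}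

theorem deriv_mul_exp_neg {a : ℝ → ℝ} (ha : Differentiable ℝ a) :
    deriv (fun t => a t * Real.exp (-t)) = fun t => (deriv a t - a t) * Real.exp (-t) := by
  ext t
  have h := (ha t).hasDerivAt.fun_mul (hasDerivAt_neg t).exp
  rw [HasDerivAt.deriv h]
  ring

/-- The linear operator falls on `a(t) e^(-t) φ(x)`. Terms in which `a` is not differentiated
combine to `φ + damping φ - Δφ`, which is at most `δ`. The others live on `t ≥ T/4`, where `Z`
controls the weight. All sources except `g` are nonnegative and are discarded. -/
theorem IsEnergySolutionWith.exponential_test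
    (sol : IsEnergySolutionWith μ β p ε f g T u U V G) (hsupp : SupportedInCone T u)
    (hpq : p.HolderConjugate q) (hT : 0 < T) (hC : 0 ≤ C) (cut : IsTimeCutoff p C T a)
    (hμ : 0 < μ) (hβ : 0 ≤ β) (hε : 0 ≤ ε) (hg : MemLp g 2 volume)
    (hf0 : ∀ᵐ x, 0 ≤ f x) (hg0 : ∀ᵐ x, 0 ≤ g x)
    (hfs : ∀ᵐ x, 1 < ‖x‖ → f x = 0) (hgs : ∀ᵐ x, 1 < ‖x‖ → g x = 0)
    {φ W : EuclideanSpace ℝ (Fin n) → ℝ} {δ Z : ℝ} (hφ : ContDiff ℝ ∞ φ) (hW : Continuous W)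
    (hδ : 0 ≤ δ) (hZ0 : 0 ≤ Z) (hφ1 : ∀ x, ‖x‖ ≤ T + 1 → 1 / 2 ≤ φ x)
    (hφ2 : ∀ x, ‖x‖ ≤ T + 1 → φ x ≤ W x)
    (hφ3 : ∀ x, ‖x‖ ≤ T + 1 → |φ x + damping μ β x * φ x - euclideanLaplacian φ x| ≤ δ)
    (hZ : ∀ t, T / 4 ≤ t → t < T →
      Real.exp (-t) * (∫ x in Metric.closedBall 0 (t + 1), W x ^ q) ^ (1 / q) ≤ Z) :
    ε * ((∫ x, g x) / 2) ≤
      (∫ t in Ioo 0 T, a t * ∫ x, |u t x| ^ p) ^ (1 / p) *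
        (((C * T⁻¹ ^ 2 + (2 + μ) * (C * T⁻¹)) * Z + δ *
            volume.real (Metric.closedBall (0 : EuclideanSpace ℝ (Fin n)) (T + 1)) ^ (1 / q)) *
          T ^ (1 / q)) := by
  obtain ⟨χ, hχ, hχc, hχ0, hχ1⟩ := exists_space_cutoff n (R := T + 1) (by linarith)
  have hχ1' : ∀ x, ‖x‖ ≤ T + 1 → χ x = 1 := fun x hx => (hχ1 x hx).eq_of_nhds
  obtain ⟨hY, hI, -⟩ := sol.integrable_nonlinearity hT hpq.pos hsupp cut.smooth cut.eq_zero hχ hχc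
    hχ1'
  set ψ : EuclideanSpace ℝ (Fin n) → ℝ := fun x => φ x * χ x with hψdef
  have hψ : ContDiff ℝ ∞ ψ := hφ.mul hχ
  have hψc : HasCompactSupport ψ := hχc.mul_left (f := φ)
  have hψ1 : ∀ x, ‖x‖ ≤ T + 1 → ψ x = φ x := fun x hx => by
    simp only [hψdef, hχ1' x hx, mul_one]
  have hψ2 : ∀ x, ‖x‖ ≤ T + 1 → euclideanLaplacian ψ x = euclideanLaplacian φ x := fun x hx =>
    euclideanLaplacian_congr (by
      filter_upwards [hχ1 x hx] with y hy
      simp only [hψdef, hy, mul_one])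
  have hψ0 : ∀ x, ‖x‖ ≤ T + 1 → 0 ≤ ψ x := fun x hx => by
    rw [hψ1 x hx]; linarith [hφ1 x hx]
  set b : ℝ → ℝ := fun t => a t * Real.exp (-t) with hb
  have ha1 : ContDiff ℝ ∞ (deriv a) := (contDiff_infty_iff_deriv.1 cut.smooth).2
  have had : Differentiable ℝ a := cut.smooth.differentiable (by simp)
  have had1 : Differentiable ℝ (deriv a) := ha1.differentiable (by simp)
  have hbs : ContDiff ℝ ∞ b := cut.smooth.mul (Real.contDiff_exp.comp contDiff_neg)
  have hb0 : ∀ t, T / 2 ≤ |t| → b t = 0 := fun t ht => by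
    simp only [hb, cut.eq_zero t ht, zero_mul]
  have hb1 : deriv b = fun t => (deriv a t - a t) * Real.exp (-t) := deriv_mul_exp_neg had
  have hb2 : deriv (deriv b) =
      fun t => (deriv (deriv a) t - 2 * deriv a t + a t) * Real.exp (-t) := by
    have hd : Differentiable ℝ fun t => deriv a t - a t := had1.fun_sub had
    rw [hb1, deriv_mul_exp_neg hd]
    ext t
    rw [deriv_fun_sub (had1 t) (had t)]
    ring
  have hid := sol.weak_separated hT hbs hb0 hψ hψc
  set X : ℝ → ℝ := fun t => ∫ x, |u t x| ^ p with hX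
  have hX0 : ∀ t, 0 ≤ X t := fun t => integral_nonneg fun x => by positivity
  have e1 : 0 ≤ ∫ t in (0 : ℝ)..T, b t * ∫ x, |u t x| ^ p * ψ x := by
    refine intervalIntegral.integral_nonneg hT.le fun t ht => ?_
    rcases ht.2.eq_or_lt with h | h
    · rw [hb0 t (by rw [abs_of_nonneg ht.1]; linarith), zero_mul]
    · refine mul_nonneg (mul_nonneg (cut.nonneg t) (Real.exp_pos _).le) (integral_nonneg_of_ae ?_)
      filter_upwards [hsupp t ⟨ht.1, h⟩] with x hx
      by_cases hxT : ‖x‖ ≤ T + 1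
      · exact mul_nonneg (by positivity) (hψ0 x hxT)
      · simp [hx (by linarith), Real.zero_rpow hpq.pos.ne']
  -- Uses `φ ≥ 1/2` on the unit ball and `g ≥ 0`.
  have e2 : (∫ x, g x) / 2 ≤ ∫ x, g x * ψ x := by
    have h1 := integral_mul_nonneg_of_support_unitBall (w := fun x => ψ x - χ x / 2) hgs hg0
      (fun x hx => by
        have := hφ1 x (by linarith)
        rw [hψ1 x (by linarith), hχ1' x (by linarith)]; linarith)
    have h2 : ∫ x, g x * χ x = ∫ x, g x := by
      have := integral_mul_eq_of_support_unitBall (w := χ) (w' := fun _ => 1) hgs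
        (fun x hx => hχ1' x (by linarith))
      simpa using this
    have h3 : ∫ x, g x * (ψ x - χ x / 2) = (∫ x, g x * ψ x) - (∫ x, g x * χ x) / 2 := by
      rw [← integral_div, ← integral_sub (integrable_mul_of_memLp_two hg hψ.continuous hψc)
        ((integrable_mul_of_memLp_two hg hχ.continuous hχc).div_const 2)]
      congr 1; ext x; ring
    rw [h3, h2] at h1
    linarith
  have e3 : 0 ≤ ∫ x, damping μ β x * f x * ψ x := by
    have := integral_mul_nonneg_of_support_unitBall (w := fun x => damping μ β x * ψ x) hfs hf0
      (fun x hx => mul_nonneg (damping_nonneg hμ.le β x) (hψ0 x (by linarith)))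
    refine this.trans (le_of_eq ?_)
    congr 1; ext x; ring
  have e4 : 0 ≤ ∫ x, f x * ψ x :=
    integral_mul_nonneg_of_support_unitBall hfs hf0 (fun x hx => hψ0 x (by linarith))
  have hb00 : b 0 = 1 := by simp [hb, cut.zero]
  -- The sign is favourable: the boundary term becomes `+ ε ∫ f ψ ≥ 0`.
  have hb10 : deriv b 0 = -1 := by rw [hb1]; simp [cut.zero, cut.deriv_zero]
  set V₁ := volume.real (Metric.closedBall (0 : EuclideanSpace ℝ (Fin n)) (T + 1)) ^ (1 / q)
  have hV₁ : 0 ≤ V₁ := by positivity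
  have hN : 0 ≤ (C * T⁻¹ ^ 2 + (2 + μ) * (C * T⁻¹)) * Z + δ * V₁ := by positivity
  have hbound := abs_intervalIntegral_le_of_rpow_bound hpq (S := 3 / 4 * T) (T := T)
    (N := (C * T⁻¹ ^ 2 + (2 + μ) * (C * T⁻¹)) * Z + δ * V₁) (Y := fun t => a t * X t)
    (F := fun t => deriv (deriv b) t * (∫ x, u t x * ψ x)
          - b t * (∫ x, u t x * euclideanLaplacian ψ x)
          - deriv b t * (∫ x, u t x * (damping μ β x * ψ x)))
    (by positivity) (by linarith) hN (fun t => mul_nonneg (cut.nonneg t) (hX0 t)) hY ?_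
  · have h1 := (le_abs_self _).trans hbound
    rw [← hid, hb00, hb10] at h1
    have h2 := mul_nonneg hε e3
    have h3 := mul_nonneg hε e4
    have h4 := mul_le_mul_of_nonneg_left e2 hε
    linarith
  filter_upwards [hI, ae_restrict_mem measurableSet_Ioo] with t hIt ht
  have ht' : t ∈ Ico 0 T := ⟨ht.1.le, ht.2⟩
  have hd1 := cut.abs_deriv_le t
  have hd2 := cut.abs_deriv_deriv_le t
  have hp0 := hpq.pos
  have hq0 := hpq.symm.pos
  have huL : MemLp (u t) 2 volume := (memLp_congr_ae (sol.curve t ht')).2 (Lp.memLp (U t))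
  have hX' := Real.rpow_nonneg (hX0 t) (1 / p)
  have ha' := Real.rpow_nonneg (cut.nonneg t) (1 / p)
  rw [hb2, hb1]
  simp only [hb]
  by_cases hat : a t = 0
  · rw [hat, Real.zero_rpow (by positivity), mul_zero] at hd1 hd2
    rw [abs_eq_zero.1 (le_antisymm hd1 (abs_nonneg _)),
      abs_eq_zero.1 (le_antisymm hd2 (abs_nonneg _)), hat]
    simp only [zero_mul, sub_zero, abs_zero, mul_zero, add_zero]
    positivity
  set I := (∫ x in Metric.closedBall 0 (t + 1), W x ^ q) ^ (1 / q)
  set M1 := ∫ x, u t x * ψ x with hM1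
  set M2 := ∫ x, u t x * euclideanLaplacian ψ x with hM2
  set M3 := ∫ x, u t x * (damping μ β x * ψ x) with hM3
  have m1 : |M1| ≤ X t ^ (1 / p) * I :=
    sol.abs_moment_le hsupp hpq ht' (hIt hat) le_rfl hW (fun x hx => by
      have hx' : ‖x‖ ≤ T + 1 := by linarith [ht.2]
      rw [abs_of_nonneg (hψ0 x hx'), hψ1 x hx']
      exact hφ2 x hx')
  -- The crude bound `damping ≤ μ` suffices, since `M3` occurs here only next to `a'`; its product
  -- with `a` is treated in `mE`.
  have m3 : |M3| ≤ μ * (X t ^ (1 / p) * I) := by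
    have h1 := sol.abs_moment_le hsupp hpq ht' (hIt hat) le_rfl
      (w := fun x => μ⁻¹ * (damping μ β x * ψ x)) hW (fun x hx => by
      have hx' : ‖x‖ ≤ T + 1 := by linarith [ht.2]
      have hd := damping_nonneg hμ.le β x
      have hd' := damping_le hμ.le hβ x
      have h0 := hψ0 x hx'
      rw [abs_of_nonneg (by positivity), ← mul_assoc]
      calc μ⁻¹ * damping μ β x * ψ x ≤ 1 * ψ x := by
            gcongr
            rw [inv_mul_le_iff₀ hμ]; linarith
        _ ≤ W x := by rw [one_mul, hψ1 x hx']; exact hφ2 x hx')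
    have h2 : M3 = μ * ∫ x, u t x * (μ⁻¹ * (damping μ β x * ψ x)) := by
      rw [hM3, ← integral_const_mul]; congr 1; ext x; field_simp
    rw [h2, abs_mul, abs_of_pos hμ]
    gcongr
  -- The moment of the residual of the eigenvalue equation.
  have mE : |M1 + M3 - M2| ≤ X t ^ (1 / p) * (δ * V₁) := by
    have h1 := sol.abs_moment_le hsupp hpq ht' (hIt hat) (R := T + 1) (by linarith [ht.2])
      (w := fun x => ψ x + damping μ β x * ψ x - euclideanLaplacian ψ x)
      (W := fun _ => δ) continuous_const (fun x hx => by
        rw [hψ1 x hx, hψ2 x hx]; exact hφ3 x hx)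
    have h2 : ∫ x, u t x * (ψ x + damping μ β x * ψ x - euclideanLaplacian ψ x) =
        M1 + M3 - M2 := by
      have i1 := integrable_mul_of_memLp_two huL hψ.continuous hψc
      have i2 := integrable_mul_of_memLp_two huL (continuous_euclideanLaplacian hψ)
        (hasCompactSupport_euclideanLaplacian hψc)
      have i3 : Integrable fun x => u t x * (damping μ β x * ψ x) :=
        integrable_mul_of_memLp_two huL ((continuous_damping μ β).mul hψ.continuous)
          (hψc.mul_left (f := damping μ β))
      rw [hM1, hM2, hM3, ← integral_add i1 i3]
      have := integral_sub (i1.add i3) i2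
      simp only [Pi.add_apply] at this
      rw [← this]
      congr 1; ext x; ring
    have h3 : (∫ _ in Metric.closedBall (0 : EuclideanSpace ℝ (Fin n)) (T + 1), δ ^ q) ^ (1 / q) =
        δ * V₁ := by
      rw [setIntegral_const, smul_eq_mul, Real.mul_rpow (by positivity) (by positivity),
        ← Real.rpow_mul hδ, mul_one_div_cancel hq0.ne', Real.rpow_one, mul_comm]
    rwa [h2, h3] at h1
  have hexp : Real.exp (-t) ≤ 1 := Real.exp_le_one_iff.2 (by linarith [ht.1])
  have hexp0 := Real.exp_pos (-t)
  have haa : a t ≤ a t ^ (1 / p) := by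
    have := Real.rpow_le_rpow_of_exponent_ge' (cut.nonneg t) (cut.le_one t)
      (by positivity : 0 ≤ 1 / p) (by rw [div_le_one hp0]; exact hpq.lt.le)
    rwa [Real.rpow_one] at this
  have r2 : |a t * (M1 + M3 - M2) * Real.exp (-t)| ≤
      a t ^ (1 / p) * X t ^ (1 / p) * (δ * V₁) := by
    rw [abs_mul, abs_mul, abs_of_nonneg (cut.nonneg t), abs_of_pos hexp0]
    calc _ ≤ a t ^ (1 / p) * (X t ^ (1 / p) * (δ * V₁)) * 1 := by gcongr
      _ = _ := by ring
  have r1 : |((deriv (deriv a) t - 2 * deriv a t) * M1 - deriv a t * M3) * Real.exp (-t)| ≤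
      a t ^ (1 / p) * X t ^ (1 / p) * ((C * T⁻¹ ^ 2 + (2 + μ) * (C * T⁻¹)) * Z) := by
    by_cases h4 : t < T / 4
    · have := cut.deriv_eq_zero t ht.1.le h4
      rw [this.1, this.2]
      simp only [zero_mul, mul_zero, sub_zero, abs_zero]
      positivity
    · have hI := hZ t (not_lt.1 h4) ht.2
      have hI0 : 0 ≤ X t ^ (1 / p) * I := (abs_nonneg _).trans m1
      have s1 : |(deriv (deriv a) t - 2 * deriv a t) * M1 - deriv a t * M3| ≤
          (C * T⁻¹ ^ 2 + (2 + μ) * (C * T⁻¹)) * a t ^ (1 / p) * (X t ^ (1 / p) * I) := by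
        calc _ ≤ (|deriv (deriv a) t| + 2 * |deriv a t|) * |M1| + |deriv a t| * |M3| := by
              refine (abs_sub _ _).trans ?_
              rw [abs_mul, abs_mul]
              gcongr
              refine (abs_sub _ _).trans ?_
              rw [abs_mul, abs_two]
          _ ≤ (C * T⁻¹ ^ 2 * a t ^ (1 / p) + 2 * (C * T⁻¹ * a t ^ (1 / p))) *
                (X t ^ (1 / p) * I) +
              (C * T⁻¹ * a t ^ (1 / p)) * (μ * (X t ^ (1 / p) * I)) := by gcongr
          _ = _ := by ring
      rw [abs_mul, abs_of_pos hexp0]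
      calc _ ≤ (C * T⁻¹ ^ 2 + (2 + μ) * (C * T⁻¹)) * a t ^ (1 / p) * (X t ^ (1 / p) * I) *
            Real.exp (-t) := by gcongr
        _ = a t ^ (1 / p) * X t ^ (1 / p) * ((C * T⁻¹ ^ 2 + (2 + μ) * (C * T⁻¹)) *
            (Real.exp (-t) * I)) := by ring
        _ ≤ _ := by gcongr
  -- The integrand is `((a'' - 2a') M1 - a' M3 + a (M1 + M3 - M2)) e^(-t)`, the sum of the
  -- quantities bounded in `r1` and `r2`.
  rw [Real.mul_rpow (cut.nonneg t) (hX0 t), mul_add]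
  refine le_trans (le_of_eq ?_) ((abs_add_le _ _).trans (add_le_add r1 r2))
  congr 1
  ring

end EnergySolution

/-! ### Exponents and powers of `T` -/

theorem gammaPoly_pos {n : ℕ} (hn : 2 ≤ n) {p : ℝ} (hp : 0 < p) (hpS : p < straussExponent n) :
    0 < gammaPoly p n := by
  have hn' : (2 : ℝ) ≤ n := by exact_mod_cast hn
  have hd : (0 : ℝ) < 2 * ((n : ℝ) - 1) := by linarith
  have h0 : (0 : ℝ) ≤ (n : ℝ) ^ 2 + 10 * n - 7 := by nlinarith
  have hs := Real.sq_sqrt h0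
  have hs0 := Real.sqrt_nonneg ((n : ℝ) ^ 2 + 10 * n - 7)
  unfold straussExponent at hpS
  rw [lt_div_iff₀ hd] at hpS
  unfold gammaPoly
  set s := √((n : ℝ) ^ 2 + 10 * n - 7)
  have hsn : (n : ℝ) + 1 < s := by nlinarith
  have h1 : 0 < ((n : ℝ) + 1 + s - p * (2 * ((n : ℝ) - 1))) *
      (p * (2 * ((n : ℝ) - 1)) - ((n : ℝ) + 1 - s)) :=
    mul_pos (by linarith) (by have := mul_pos hp hd; linarith)
  nlinarith

/-- Dropping `x` gives `J^(1/q) ≤ B`, hence `J^(1/p) ≤ B^(q/p) = B^(q-1)`. Inserting this back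
bounds `x`. -/
theorem bounds_of_add_le_rpow_mul {p q J x B : ℝ} (hpq : p.HolderConjugate q) (hJ : 0 ≤ J)
    (hx : 0 ≤ x) (hB : 0 ≤ B) (h : x + J ≤ J ^ (1 / p) * B) :
    x ≤ B ^ q ∧ J ^ (1 / p) ≤ B ^ (q - 1) := by
  have hp0 := hpq.pos
  have hq0 := hpq.symm.pos
  have hq1 := hpq.symm.lt
  have hqp : q / p = q - 1 := by
    have := hpq.inv_add_inv_eq_one
    field_simp at this ⊢
    linarith
  have h1 : J ^ (1 / p) ≤ B ^ (q - 1) := by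
    rcases hJ.eq_or_lt with h0 | h0
    · rw [← h0, Real.zero_rpow (by positivity)]; positivity
    · have e : J = J ^ (1 / p) * J ^ (1 / q) := by
        rw [← Real.rpow_add h0, one_div, one_div, hpq.inv_add_inv_eq_one, Real.rpow_one]
      have h2 : J ^ (1 / q) ≤ B := by
        have h3 : J ^ (1 / p) * J ^ (1 / q) ≤ J ^ (1 / p) * B := by rw [← e]; linarith
        exact le_of_mul_le_mul_left h3 (by positivity)
      calc J ^ (1 / p) = (J ^ (1 / q)) ^ (q - 1) := by
            rw [← Real.rpow_mul hJ, ← hqp]; congr 1; field_simp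
        _ ≤ _ := Real.rpow_le_rpow (by positivity) h2 (by linarith)
  refine ⟨?_, h1⟩
  calc x ≤ J ^ (1 / p) * B := by linarith
    _ ≤ B ^ (q - 1) * B := by gcongr
    _ = B ^ q := by
      rcases hB.eq_or_lt with h0 | h0
      · rw [← h0, mul_zero, Real.zero_rpow hq0.ne']
      · rw [Real.rpow_sub_one h0.ne']; field_simp

theorem le_rpow_of_le_mul_rpow_neg {T ε M e : ℝ} (hT : 0 < T) (hε : 0 < ε) (hM : 0 ≤ M)
    (he : 0 < e) (h : ε ≤ M * T ^ (-(1 / e))) : T ≤ M ^ e * ε ^ (-e) := by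
  have h1 : T ^ (1 / e) ≤ M / ε := by
    rw [le_div_iff₀ hε]
    rw [Real.rpow_neg hT.le, ← div_eq_mul_inv, le_div_iff₀ (by positivity)] at h
    linarith
  calc T = (T ^ (1 / e)) ^ e := by
        rw [← Real.rpow_mul hT.le, one_div_mul_cancel he.ne', Real.rpow_one]
    _ ≤ (M / ε) ^ e := by gcongr
    _ = _ := by rw [Real.div_rpow hM hε.le, Real.rpow_neg hε.le, div_eq_mul_inv]

theorem exists_volume_closedBall_rpow_le {n : ℕ} (hn : 0 < n) {q : ℝ} (hq : 0 < q) :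
    ∃ C : ℝ, 0 < C ∧ ∀ T : ℝ, 1 ≤ T →
      volume.real (Metric.closedBall (0 : EuclideanSpace ℝ (Fin n)) (T + 1)) ^ (1 / q) ≤
        C * T ^ (n / q) := by
  obtain ⟨C, hC, h⟩ := exists_setIntegral_one_add_norm_le hn (q := 0) (by exact_mod_cast hn)
  refine ⟨(C * 3 ^ (n : ℝ)) ^ (1 / q), by positivity, fun T hT => ?_⟩
  have h1 := h (T + 1) (by linarith)
  simp only [neg_zero, Real.rpow_zero, setIntegral_const, smul_eq_mul, mul_one, sub_zero] at h1
  calc _ ≤ (C * (1 + (T + 1)) ^ (n : ℝ)) ^ (1 / q) := by gcongr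
    _ ≤ (C * (3 * T) ^ (n : ℝ)) ^ (1 / q) := by
      have : 1 + (T + 1) ≤ 3 * T := by linarith
      refine Real.rpow_le_rpow (by positivity) ?_ (by positivity)
      gcongr
    _ = (C * 3 ^ (n : ℝ) * T ^ (n : ℝ)) ^ (1 / q) := by
      rw [Real.mul_rpow (x := 3) (y := T) (by norm_num) (by linarith), mul_assoc]
    _ = _ := by
      rw [Real.mul_rpow (by positivity) (by positivity), ← Real.rpow_mul (by linarith),
        mul_one_div]

theorem damping_rpow {n : ℕ} {μ β q : ℝ} (hμ : 0 ≤ μ) (x : EuclideanSpace ℝ (Fin n)) :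
    damping μ β x ^ q = μ ^ q * (1 + ‖x‖) ^ (-(β * q)) := by
  have h : (0 : ℝ) ≤ 1 + ‖x‖ := by positivity
  rw [damping, Real.div_rpow hμ (by positivity), ← Real.rpow_mul h, Real.rpow_neg h,
    div_eq_mul_inv]

theorem exists_damping_norm_le_const {n : ℕ} {μ β q : ℝ} (hμ : 0 ≤ μ) (hq : 0 < q)
    (hβq : n < β * q) :
    ∃ C : ℝ, 0 < C ∧ ∀ R : ℝ,
      (∫ x in Metric.closedBall (0 : EuclideanSpace ℝ (Fin n)) R, damping μ β x ^ q) ^ (1 / q) ≤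
        C := by
  have hnn : ∀ x : EuclideanSpace ℝ (Fin n), 0 ≤ damping μ β x ^ q := fun x =>
    Real.rpow_nonneg (damping_nonneg hμ β x) _
  have hint : Integrable (fun x : EuclideanSpace ℝ (Fin n) => damping μ β x ^ q) := by
    simp only [damping_rpow hμ]
    exact (integrable_one_add_norm (by simpa using hβq)).const_mul _
  have h0 : 0 ≤ (∫ x : EuclideanSpace ℝ (Fin n), damping μ β x ^ q) ^ (1 / q) :=
    Real.rpow_nonneg (integral_nonneg hnn) _
  refine ⟨(∫ x : EuclideanSpace ℝ (Fin n), damping μ β x ^ q) ^ (1 / q) + 1, by linarith,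
    fun R => ?_⟩
  refine le_trans (Real.rpow_le_rpow (integral_nonneg hnn) ?_ (by positivity))
    (le_add_of_nonneg_right zero_le_one)
  exact setIntegral_le_integral hint (Filter.Eventually.of_forall hnn)

/-- Decay of order one already suffices here: for `q < n` it makes `T⁻¹ ‖damping‖` no larger than
`T⁻² ‖1‖` in order, so the damping does not worsen the first test. -/
theorem exists_damping_norm_le_rpow {n : ℕ} (hn : 0 < n) {μ β q : ℝ} (hμ : 0 < μ) (hβ : 1 ≤ β)
    (hq : 0 < q) (hqn : q < n) :
    ∃ C : ℝ, 0 < C ∧ ∀ T : ℝ, 1 ≤ T →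
      (∫ x in Metric.closedBall (0 : EuclideanSpace ℝ (Fin n)) (T + 1),
        damping μ β x ^ q) ^ (1 / q) ≤ C * T ^ (n / q - 1) := by
  obtain ⟨C, hC, h⟩ := exists_setIntegral_one_add_norm_le hn hqn
  refine ⟨(μ ^ q * C * 3 ^ (n - q)) ^ (1 / q), by positivity, fun T hT => ?_⟩
  have hnn : ∀ x : EuclideanSpace ℝ (Fin n), 0 ≤ damping μ β x ^ q := fun x =>
    Real.rpow_nonneg (damping_nonneg hμ.le β x) _
  have hcpt := isCompact_closedBall (0 : EuclideanSpace ℝ (Fin n)) (T + 1)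
  have h1 : ∫ x in Metric.closedBall (0 : EuclideanSpace ℝ (Fin n)) (T + 1), damping μ β x ^ q ≤
      μ ^ q * C * 3 ^ (n - q) * T ^ (n - q) := by
    have hpos : ∀ x : EuclideanSpace ℝ (Fin n), 0 < 1 + ‖x‖ := fun x => by positivity
    calc _ ≤ ∫ x in Metric.closedBall (0 : EuclideanSpace ℝ (Fin n)) (T + 1),
          μ ^ q * (1 + ‖x‖) ^ (-q) := by
          refine setIntegral_mono_on ?_ ?_ Metric.isClosed_closedBall.measurableSet fun x _ => ?_
          · exact ((continuous_damping μ β).rpow_const fun x => Or.inr hq.le).continuousOn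
              |>.integrableOn_compact hcpt
          · exact (continuous_const.mul (Continuous.rpow_const (by fun_prop)
              fun x => Or.inl (hpos x).ne')).continuousOn.integrableOn_compact hcpt
          · rw [damping_rpow hμ.le]
            gcongr
            · linarith [norm_nonneg x]
            · nlinarith
      _ = μ ^ q * ∫ x in Metric.closedBall (0 : EuclideanSpace ℝ (Fin n)) (T + 1),
          (1 + ‖x‖) ^ (-q) := integral_const_mul _ _
      _ ≤ μ ^ q * (C * (1 + (T + 1)) ^ (n - q)) := by
          gcongr
          exact h (T + 1) (by linarith)
      _ ≤ μ ^ q * (C * (3 * T) ^ (n - q)) := by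
          have h2 : 1 + (T + 1) ≤ 3 * T := by linarith
          have h3 := Real.rpow_le_rpow (by linarith) h2 (by linarith : 0 ≤ n - q)
          gcongr
      _ = _ := by
          rw [Real.mul_rpow (x := 3) (y := T) (by norm_num) (by linarith)]; ring
  calc _ ≤ (μ ^ q * C * 3 ^ (n - q) * T ^ (n - q)) ^ (1 / q) :=
        Real.rpow_le_rpow (integral_nonneg hnn) h1 (by positivity)
    _ = _ := by
      rw [Real.mul_rpow (by positivity) (by positivity), ← Real.rpow_mul (by linarith)]
      congr 2
      field_simp

/-- The restriction `T/4 ≤ t < T` makes `2 + t` comparable to `T`, so the bound is a pure power of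
`T` even when the exponent is negative. -/
theorem exists_cone_weight_norm_le {n : ℕ} (hn : 0 < n) {m q K : ℝ} (hq : 1 ≤ q) (hK : 0 < K) :
    ∃ C : ℝ, 0 < C ∧ ∀ T : ℝ, 1 ≤ T → ∀ t : ℝ, T / 4 ≤ t → t < T →
      Real.exp (-t) * (∫ x in Metric.closedBall (0 : EuclideanSpace ℝ (Fin n)) (t + 1),
        (K * ((1 + ‖x‖) ^ (-m) * Real.exp ‖x‖)) ^ q) ^ (1 / q) ≤
          C * T ^ (((n : ℝ) - 1 - m * q) / q) := by
  have hq0 : 0 < q := by linarith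
  obtain ⟨C, hC, h⟩ := exists_setIntegral_cone_weight_le hn (m := m) hq
  set b := (n : ℝ) - 1 - m * q
  refine ⟨K * (C * 4 ^ |b|) ^ (1 / q), by positivity, fun T hT t ht htT => ?_⟩
  have ht0 : 0 ≤ t := by linarith
  have hT0 : 0 < T := by linarith
  have e1 : ∀ x : EuclideanSpace ℝ (Fin n), (K * ((1 + ‖x‖) ^ (-m) * Real.exp ‖x‖)) ^ q =
      (K * Real.exp t) ^ q * ((1 + ‖x‖) ^ (-m) * Real.exp ‖x‖ * Real.exp (-t)) ^ q := fun x => by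
    rw [← Real.mul_rpow (by positivity) (by positivity)]
    congr 1
    rw [Real.exp_neg]
    have := (Real.exp_pos t).ne'
    field_simp
  have h1 := h t ht0
  have h2 : (2 + t) ^ b ≤ 4 ^ |b| * T ^ b := by
    have e : (2 + t) ^ b = ((2 + t) / T) ^ b * T ^ b := by
      rw [Real.div_rpow (by positivity) hT0.le]
      have : T ^ b ≠ 0 := by positivity
      field_simp
    rw [e]
    gcongr
    rcases le_total 0 b with hb | hb
    · rw [abs_of_nonneg hb]
      refine Real.rpow_le_rpow (by positivity) ?_ hb
      rw [div_le_iff₀ hT0]; linarith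
    · rw [abs_of_nonpos hb, Real.rpow_neg (by norm_num), ← Real.inv_rpow (by norm_num)]
      refine Real.rpow_le_rpow_of_nonpos (by norm_num) ?_ hb
      rw [le_div_iff₀ hT0]; linarith
  simp only [e1]
  rw [integral_const_mul, Real.mul_rpow (by positivity) (integral_nonneg fun x => by positivity),
    ← Real.rpow_mul (by positivity), mul_one_div_cancel hq0.ne', Real.rpow_one]
  have h3 : (∫ x in Metric.closedBall (0 : EuclideanSpace ℝ (Fin n)) (t + 1),
      ((1 + ‖x‖) ^ (-m) * Real.exp ‖x‖ * Real.exp (-t)) ^ q) ^ (1 / q) ≤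
      (C * 4 ^ |b|) ^ (1 / q) * T ^ (b / q) := by
    calc _ ≤ (C * 4 ^ |b| * T ^ b) ^ (1 / q) := by
          refine Real.rpow_le_rpow (integral_nonneg fun x => by positivity) (h1.trans ?_)
            (by positivity)
          rw [mul_assoc]; gcongr
      _ = _ := by
        rw [Real.mul_rpow (by positivity) (by positivity), ← Real.rpow_mul hT0.le, mul_one_div]
  calc _ = K * (Real.exp (-t) * Real.exp t) *
        (∫ x in Metric.closedBall (0 : EuclideanSpace ℝ (Fin n)) (t + 1),
          ((1 + ‖x‖) ^ (-m) * Real.exp ‖x‖ * Real.exp (-t)) ^ q) ^ (1 / q) := by ring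
    _ ≤ K * 1 * ((C * 4 ^ |b|) ^ (1 / q) * T ^ (b / q)) := by
      rw [← Real.exp_add, neg_add_cancel, Real.exp_zero]
      gcongr
    _ = _ := by ring

/-! ### The two lifespan estimates -/

section Lifespan

variable {n : ℕ} {μ β p : ℝ} {f g : EuclideanSpace ℝ (Fin n) → ℝ}

theorem integral_pos_of_support_unitBall (hg : MemLp g 2 volume) (hg0 : ∀ᵐ x, 0 ≤ g x)
    (hne : ¬ ∀ᵐ x, g x = 0) (hgs : ∀ᵐ x, 1 < ‖x‖ → g x = 0) : 0 < ∫ x, g x := by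
  obtain ⟨χ, hχ, hχc, -, hχ1⟩ := exists_space_cutoff n (R := 1) zero_lt_one
  have hint : Integrable g := by
    refine (integrable_mul_of_memLp_two hg hχ.continuous hχc).congr ?_
    filter_upwards [hgs] with x hx
    by_cases h : ‖x‖ ≤ 1
    · rw [(hχ1 x h).eq_of_nhds, mul_one]
    · rw [hx (not_le.1 h), zero_mul]
  refine lt_of_le_of_ne (integral_nonneg_of_ae hg0) fun h => hne ?_
  exact (integral_eq_zero_iff_of_nonneg_ae hg0 hint).1 h.symm

theorem lifespan_of_le (hn : 2 ≤ n) (hμ : 0 < μ) (hβ : 2 < β) (hp : 1 < p)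
    (hpn : p ≤ (n : ℝ) / ((n : ℝ) - 1)) (hg : MemLp g 2 volume)
    (hf0 : ∀ᵐ x, 0 ≤ f x) (hg0 : ∀ᵐ x, 0 ≤ g x) (hg_ne : ¬ ∀ᵐ x, g x = 0)
    (hfs : ∀ᵐ x, 1 < ‖x‖ → f x = 0) (hgs : ∀ᵐ x, 1 < ‖x‖ → g x = 0) :
    ∃ M : ℝ, 0 < M ∧ ∀ ε : ℝ, 0 < ε → ε ≤ 1 → ∀ T : ℝ, 1 ≤ T →
      ∀ u : ℝ → EuclideanSpace ℝ (Fin n) → ℝ, IsEnergySolution μ β p ε f g T u →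
        SupportedInCone T u →
        T ≤ M * ε ^ (-(2 * (p - 1) / ((n : ℝ) + 1 - ((n : ℝ) - 1) * p))) := by
  have hn' : (2 : ℝ) ≤ n := by exact_mod_cast hn
  have hn0 : 0 < n := by omega
  have hc := integral_pos_of_support_unitBall hg hg0 hg_ne hgs
  set c := ∫ x, g x
  have hpq : p.HolderConjugate (p / (p - 1)) := Real.HolderConjugate.conjExponent hp
  set q := p / (p - 1) with hq
  have hp1 : 0 < p - 1 := by linarith
  have hq1 : q - 1 = 1 / (p - 1) := by rw [hq]; field_simp; ring
  have hq0 : 0 < q := hpq.symm.pos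
  -- Dual form of `p ≤ n/(n-1)`. It puts the damping in `L^q` and bounds `T^(n/q)` by `T`.
  have hnq : (n : ℝ) ≤ q := by
    rw [le_div_iff₀ (by linarith)] at hpn
    rw [hq, le_div_iff₀ hp1]; linarith
  obtain ⟨C, hC, hcut⟩ := exists_isTimeCutoff hp
  obtain ⟨C₁, hC₁, hV₁⟩ := exists_volume_closedBall_rpow_le hn0 hq0
  obtain ⟨C₂, hC₂, hV₂⟩ := exists_damping_norm_le_const (n := n) (β := β) hμ.le hq0 (by nlinarith)
  refine ⟨((C * (C₁ + C₂)) ^ q / c) ^ (p - 1), by positivity, ?_⟩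
  rintro ε hε hε1 T hT u ⟨U, V, G, sol⟩ hsupp
  have hT0 : 0 < T := by linarith
  obtain ⟨a, cut⟩ := hcut T hT0
  have htest := sol.time_cutoff_test hsupp hpq hT0 hC.le cut hμ.le hε.le hf0 hfs hgs
  set V₁ := volume.real (Metric.closedBall (0 : EuclideanSpace ℝ (Fin n)) (T + 1)) ^ (1 / q)
  set V₂ := (∫ x in Metric.closedBall (0 : EuclideanSpace ℝ (Fin n)) (T + 1),
            damping μ β x ^ q) ^ (1 / q)
  have hV₂0 : 0 ≤ V₂ := Real.rpow_nonneg (integral_nonneg fun x =>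
    Real.rpow_nonneg (damping_nonneg hμ.le β x) _) _
  have hJ : 0 ≤ ∫ t in Ioo 0 T, a t * ∫ x, |u t x| ^ p :=
    integral_nonneg fun t => mul_nonneg (cut.nonneg t) (integral_nonneg fun x => by positivity)
  have h1 := (bounds_of_add_le_rpow_mul hpq hJ (by positivity) (by positivity) htest).1
  have hV₁' : V₁ ≤ C₁ * T := by
    refine (hV₁ T hT).trans ?_
    gcongr
    calc T ^ (n / q) ≤ T ^ (1 : ℝ) :=
          Real.rpow_le_rpow_of_exponent_le hT (by rwa [div_le_one hq0])
      _ = T := Real.rpow_one T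
  have h2 : C * (T⁻¹ ^ 2 * V₁ + T⁻¹ * V₂) * T ^ (1 / q) ≤
      C * (C₁ + C₂) * T ^ (1 / q - 1) := by
    calc _ ≤ C * (T⁻¹ ^ 2 * (C₁ * T) + T⁻¹ * C₂) * T ^ (1 / q) := by
          gcongr
          exact hV₂ (T + 1)
      _ = C * (C₁ + C₂) * (T ^ (1 / q) * T⁻¹) := by field_simp
      _ = _ := by rw [Real.rpow_sub_one hT0.ne', div_eq_mul_inv (T ^ (1 / q))]
  have h3 : ε ≤ (C * (C₁ + C₂)) ^ q / c * T ^ (-(1 / (p - 1))) := by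
    rw [div_mul_eq_mul_div, le_div_iff₀ hc]
    calc ε * c ≤ (C * (C₁ + C₂) * T ^ (1 / q - 1)) ^ q :=
          h1.trans (Real.rpow_le_rpow (by positivity) h2 hq0.le)
      _ = _ := by
        rw [Real.mul_rpow (by positivity) (by positivity), ← Real.rpow_mul hT0.le, ← hq1]
        congr 2
        field_simp
        ring
  refine (le_rpow_of_le_mul_rpow_neg hT0 hε (by positivity) hp1 h3).trans ?_
  refine mul_le_mul_of_nonneg_left ?_ (by positivity)
  -- The exponent obtained is `p - 1`. It is at most the claimed one because `n + 1 - (n-1)p ≤ 2`,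
  -- and `ε ≤ 1`.
  refine Real.rpow_le_rpow_of_exponent_ge hε hε1 (neg_le_neg ?_)
  have hpn' := hpn
  rw [le_div_iff₀ (by linarith)] at hpn'
  have hD : 0 < (n : ℝ) + 1 - ((n : ℝ) - 1) * p := by linarith
  have hD2 : (n : ℝ) + 1 - ((n : ℝ) - 1) * p ≤ 2 := by nlinarith
  rw [le_div_iff₀ hD]
  nlinarith

theorem lifespan_of_lt (hn : 2 ≤ n) (hμ : 0 < μ) (hβ : 2 < β) (hp : 1 < p)
    (hpS : p < straussExponent n)
    (hpn : (n : ℝ) / ((n : ℝ) - 1) < p) (hg : MemLp g 2 volume)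
    (hf0 : ∀ᵐ x, 0 ≤ f x) (hg0 : ∀ᵐ x, 0 ≤ g x) (hg_ne : ¬ ∀ᵐ x, g x = 0)
    (hfs : ∀ᵐ x, 1 < ‖x‖ → f x = 0) (hgs : ∀ᵐ x, 1 < ‖x‖ → g x = 0) :
    ∃ M : ℝ, 0 < M ∧ ∀ ε : ℝ, 0 < ε → ∀ T : ℝ, 1 ≤ T →
      ∀ u : ℝ → EuclideanSpace ℝ (Fin n) → ℝ, IsEnergySolution μ β p ε f g T u →
        SupportedInCone T u → T ≤ M * ε ^ (-(2 * p * (p - 1) / gammaPoly p n)) := by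
  have hn' : (2 : ℝ) ≤ n := by exact_mod_cast hn
  have hn0 : 0 < n := by omega
  have hc := integral_pos_of_support_unitBall hg hg0 hg_ne hgs
  set c := ∫ x, g x
  have hpq : p.HolderConjugate (p / (p - 1)) := Real.HolderConjugate.conjExponent hp
  have hγ := gammaPoly_pos hn (by linarith) hpS
  set q := p / (p - 1) with hq
  have hp1 : 0 < p - 1 := by linarith
  have hq0 : 0 < q := hpq.symm.pos
  have hq1 : 1 < q := hpq.symm.lt
  have hqn : q < n := by
    rw [div_lt_iff₀ (by linarith)] at hpn
    rw [hq, div_lt_iff₀ hp1]; linarith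
  obtain ⟨C, hC, hcut⟩ := exists_isTimeCutoff hp
  obtain ⟨C₁, hC₁, hV₁⟩ := exists_volume_closedBall_rpow_le hn0 hq0
  obtain ⟨C₂, hC₂, hV₂⟩ := exists_damping_norm_le_rpow hn0 (β := β) hμ (by linarith) hq0 hqn
  obtain ⟨K, hK, hφ⟩ := exists_smooth_approx_eigenfunction hn0 hμ.le hβ.le
  set m := ((n : ℝ) - 1) / 2 with hm
  obtain ⟨C₃, hC₃, hZ⟩ := exists_cone_weight_norm_le hn0 (m := m) hq1.le hK
  set b := (n : ℝ) - 1 - m * q with hb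
  set A := (C + (2 + μ) * C) * C₃ + 1 with hA
  have hA0 : 0 < A := by positivity
  set e := 2 * p * (p - 1) / gammaPoly p n with he
  have he0 : 0 < e := by positivity
  refine ⟨((C * (C₁ + C₂)) ^ (q - 1) * A / (c / 2)) ^ e, by positivity, ?_⟩
  rintro ε hε T hT u ⟨U, V, G, sol⟩ hsupp
  have hT0 : 0 < T := by linarith
  obtain ⟨a, cut⟩ := hcut T hT0
  have htest := sol.time_cutoff_test hsupp hpq hT0 hC.le cut hμ.le hε.le hf0 hfs hgs
  set V₁ := volume.real (Metric.closedBall (0 : EuclideanSpace ℝ (Fin n)) (T + 1)) ^ (1 / q)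
    with hV₁def
  set V₂ := (∫ x in Metric.closedBall (0 : EuclideanSpace ℝ (Fin n)) (T + 1),
            damping μ β x ^ q) ^ (1 / q)
  have hV₁0 : 0 ≤ V₁ := by positivity
  have hV₂0 : 0 ≤ V₂ := Real.rpow_nonneg (integral_nonneg fun x =>
    Real.rpow_nonneg (damping_nonneg hμ.le β x) _) _
  -- The approximation error may depend on `T`: this choice makes its contribution `δ V₁` at most
  -- `T^(-1 + b/q)`, the order of the main term.
  set δ := min 1 (T ^ (-1 + b / q) / (1 + V₁)) with hδ
  have hδ0 : 0 < δ := lt_min zero_lt_one (by positivity)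
  have hδV : δ * V₁ ≤ T ^ (-1 + b / q) := by
    calc δ * V₁ ≤ T ^ (-1 + b / q) / (1 + V₁) * (1 + V₁) := by
          gcongr
          · exact min_le_right _ _
          · linarith
      _ = _ := by field_simp
  obtain ⟨φ, hφs, hφ'⟩ := hφ (T + 1) δ hδ0 (min_le_left _ _)
  have hexp := sol.exponential_test hsupp hpq hT0 hC.le cut hμ (by linarith) hε.le hg hf0 hg0 hfs hgs
    (W := fun x => K * ((1 + ‖x‖) ^ (-m) * Real.exp ‖x‖)) (δ := δ) (Z := C₃ * T ^ (b / q)) hφs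
    (by
      have hpos : ∀ x : EuclideanSpace ℝ (Fin n), 0 < 1 + ‖x‖ := fun x => by positivity
      have : Continuous fun x : EuclideanSpace ℝ (Fin n) => (1 + ‖x‖) ^ (-m) :=
        Continuous.rpow_const (by fun_prop) fun x => Or.inl (hpos x).ne'
      fun_prop)
    hδ0.le (by positivity) (fun x hx => (hφ' x hx).1) (fun x hx => (hφ' x hx).2.1)
    (fun x hx => (hφ' x hx).2.2) (hZ T hT)
  set J := ∫ t in Ioo 0 T, a t * ∫ x, |u t x| ^ p
  have hJ : 0 ≤ J :=
    integral_nonneg fun t => mul_nonneg (cut.nonneg t) (integral_nonneg fun x => by positivity)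
  have h1 := (bounds_of_add_le_rpow_mul hpq hJ (by positivity) (by positivity) htest).2
  have h2 : C * (T⁻¹ ^ 2 * V₁ + T⁻¹ * V₂) * T ^ (1 / q) ≤
      C * (C₁ + C₂) * T ^ (-2 + (n + 1) / q) := by
    calc _ ≤ C * (T⁻¹ ^ 2 * (C₁ * T ^ (n / q)) + T⁻¹ * (C₂ * T ^ (n / q - 1))) * T ^ (1 / q) := by
          gcongr
          · exact hV₁ T hT
          · exact hV₂ T hT
      _ = C * (C₁ + C₂) * (T⁻¹ ^ 2 * T ^ (n / q) * T ^ (1 / q)) := by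
          rw [Real.rpow_sub_one hT0.ne']; field_simp
      _ = _ := by
          have : T⁻¹ ^ 2 = T ^ (-2 : ℝ) := by
            rw [Real.rpow_neg hT0.le, inv_pow]; norm_cast
          rw [this, ← Real.rpow_add hT0, ← Real.rpow_add hT0]
          congr 2
          ring
  have h3 : ((C * T⁻¹ ^ 2 + (2 + μ) * (C * T⁻¹)) * (C₃ * T ^ (b / q)) + δ * V₁) * T ^ (1 / q) ≤
      A * T ^ (-1 + b / q + 1 / q) := by
    have hTi : T⁻¹ ^ 2 ≤ T⁻¹ := by
      have h0 : 0 < T⁻¹ := by positivity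
      have h1 : T⁻¹ ≤ 1 := inv_le_one_of_one_le₀ hT
      nlinarith
    have hTb : T⁻¹ * T ^ (b / q) = T ^ (-1 + b / q) := by
      rw [Real.rpow_add hT0, Real.rpow_neg_one]
    calc _ ≤ ((C * T⁻¹ + (2 + μ) * (C * T⁻¹)) * (C₃ * T ^ (b / q)) + T ^ (-1 + b / q)) *
          T ^ (1 / q) := by gcongr
      _ = ((C + (2 + μ) * C) * C₃ * (T⁻¹ * T ^ (b / q)) + T ^ (-1 + b / q)) * T ^ (1 / q) := by
          ring
      _ = A * (T ^ (-1 + b / q) * T ^ (1 / q)) := by rw [hTb, hA]; ring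
      _ = _ := by rw [← Real.rpow_add hT0]
  -- The upper bound for `J^(1/p)` and the factor from the exponential test together give
  -- `T^(-γ/(2p(p-1)))`.
  have hκ : (-2 + (n + 1) / q) * (q - 1) + (-1 + b / q + 1 / q) = -(1 / e) := by
    rw [he, hb, hm, hq]
    have : gammaPoly p n ≠ 0 := hγ.ne'
    field_simp
    unfold gammaPoly
    ring
  have h4 : ε ≤ (C * (C₁ + C₂)) ^ (q - 1) * A / (c / 2) * T ^ (-(1 / e)) := by
    rw [div_mul_eq_mul_div, le_div_iff₀ (by positivity)]
    calc ε * (c / 2) ≤ (C * (C₁ + C₂) * T ^ (-2 + (n + 1) / q)) ^ (q - 1) *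
          (A * T ^ (-1 + b / q + 1 / q)) := by
          refine hexp.trans ?_
          refine mul_le_mul (h1.trans (Real.rpow_le_rpow (by positivity) h2 (by linarith))) h3
            (by positivity) (by positivity)
      _ = (C * (C₁ + C₂)) ^ (q - 1) * A *
          (T ^ ((-2 + (n + 1) / q) * (q - 1)) * T ^ (-1 + b / q + 1 / q)) := by
          rw [Real.mul_rpow (by positivity) (by positivity), ← Real.rpow_mul hT0.le]; ring
      _ = _ := by rw [← Real.rpow_add hT0, hκ]
  exact le_rpow_of_le_mul_rpow_neg hT0 hε (by positivity) he0 h4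

end Lifespan

theorem theorem2p1 (n : ℕ) (hn : 2 ≤ n) (μ β p : ℝ) (hμ : 0 < μ) (hβ : 2 < β)
    (hp : 1 < p) (hpS : p < straussExponent n)
    (f g : EuclideanSpace ℝ (Fin n) → ℝ)
    (hf : MemH1 f) (hg : MemLp g 2 volume)
    (hf_nonneg : ∀ᵐ x, 0 ≤ f x) (hg_nonneg : ∀ᵐ x, 0 ≤ g x)
    (hf_ne : ¬ ∀ᵐ x, f x = 0) (hg_ne : ¬ ∀ᵐ x, g x = 0)
    (hf_supp : ∀ᵐ x, 1 < ‖x‖ → f x = 0) (hg_supp : ∀ᵐ x, 1 < ‖x‖ → g x = 0) :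
    ∃ ε₀ : ℝ, 0 < ε₀ ∧ ∃ C : ℝ, 0 < C ∧
      ∀ ε : ℝ, 0 < ε → ε ≤ ε₀ →
      ∀ T : ℝ, 0 < T →
      ∀ u : ℝ → EuclideanSpace ℝ (Fin n) → ℝ,
        IsEnergySolution μ β p ε f g T u → SupportedInCone T u →
        (p ≤ (n : ℝ) / ((n : ℝ) - 1) →
          T ≤ C * ε ^ (-(2 * (p - 1) / ((n : ℝ) + 1 - ((n : ℝ) - 1) * p)))) ∧
        ((n : ℝ) / ((n : ℝ) - 1) < p →
          T ≤ C * ε ^ (-(2 * p * (p - 1) / gammaPoly p n))) := by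
  have hn' : (2 : ℝ) ≤ n := by exact_mod_cast hn
  -- The estimates above need `T ≥ 1`. For `T < 1` the claim is immediate since `ε^(-e) ≥ 1` when `ε
  -- ≤ 1`, which is why `ε₀ = 1` and `C = max M 1` are taken.
  have hshort : ∀ {T ε M e : ℝ}, T < 1 → 0 < ε → ε ≤ 1 → 0 ≤ e → T ≤ (M ⊔ 1) * ε ^ (-e) := by
    intro T ε M e hT hε hε1 he
    have h1 : 1 ≤ ε ^ (-e) := Real.one_le_rpow_of_pos_of_le_one_of_nonpos hε hε1 (by linarith)
    have h2 : (1 : ℝ) ≤ M ⊔ 1 := le_sup_right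
    nlinarith
  rcases le_or_gt p ((n : ℝ) / ((n : ℝ) - 1)) with hpn | hpn
  · obtain ⟨M, hM, h⟩ := lifespan_of_le hn hμ hβ hp hpn hg hf_nonneg hg_nonneg hg_ne hf_supp hg_supp
    refine ⟨1, one_pos, M ⊔ 1, by positivity, fun ε hε hε1 T hT u hu hsupp =>
      ⟨fun _ => ?_, fun hlt => absurd hpn (not_le.2 hlt)⟩⟩
    have hD : 0 < (n : ℝ) + 1 - ((n : ℝ) - 1) * p := by
      rw [le_div_iff₀ (by linarith)] at hpn; linarith
    rcases lt_or_ge T 1 with hT1 | hT1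
    · exact hshort hT1 hε hε1 (div_nonneg (by linarith) hD.le)
    · exact (h ε hε hε1 T hT1 u hu hsupp).trans
        (mul_le_mul_of_nonneg_right le_sup_left (by positivity))
  · obtain ⟨M, hM, h⟩ := lifespan_of_lt hn hμ hβ hp hpS hpn hg hf_nonneg hg_nonneg hg_ne hf_supp
      hg_supp
    refine ⟨1, one_pos, M ⊔ 1, by positivity, fun ε hε hε1 T hT u hu hsupp =>
      ⟨fun hle => absurd hpn (not_lt.2 hle), fun _ => ?_⟩⟩
    have hγ := gammaPoly_pos hn (by linarith) hpS
    rcases lt_or_ge T 1 with hT1 | hT1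
    · have hp1 : 0 < p - 1 := by linarith
      exact hshort hT1 hε hε1 (by positivity)
    · exact (h ε hε T hT1 u hu hsupp).trans
        (mul_le_mul_of_nonneg_right le_sup_left (by positivity))
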